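/- **Setting.** There are $K\ge 1$ users; user $j$ holds $n_j\ge 1$ samples $z_{1j},\dots,z_{n_jj}$. Let $\ell(w;z)$ be a loss, differentiable in $w\in\mathbb R^d$ on every sample, and put $f_j(w)=\frac1{n_j}\sum_{n}\ell(w;z_{nj})$, $\rho_j=n_j/\sum_k n_k$ and $f=\sum_j\rho_jf_j$. Assume that $f$ has a minimizer $w^*$. **Algorithm.** Fix $T\ge1$ rounds, $L\ge 1$ local steps, a step size $\alpha>0$, a constant $\epsilon_a>0$, batch sizes $1\le\xi_j\le n_j$, bit numbers $b_j\ge2$, thresholds $\lambda_j\in[0,1]$, and $w_0\in\mathbb R^d$. In round $t=1,\dots,T$ user $j$ starts from $w^j_{0,t}=w_{t-1}$ and for $h=1,\dots,L$ sets $$w^j_{h,t}=w^j_{h-1,t}-\frac{\alpha}{\sqrt{g^j_{h,t}+\epsilon_a}}\odot\nabla^j_{h-1,t},\qquad g^j_{1,t}=0,\quad g^j_{h,t}=g^j_{h-1,t}+\nabla^j_{h-1,t}\odot\nabla^j_{h-1,t}\ (h\ge2),$$ where $\nabla^j_{h-1,t}$ is the sum of the gradients of $\ell(\cdot\,;z_{nj})$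 at $w^j_{h-1,t}$ over a fresh mini-batch, a uniformly random set of $\xi_j$ samples of user $j$, independent of all other mini-batches. With $\delta w^j_t=w^j_{L,t}-w_{t-1}$ the server sets $w_t=w_{t-1}+\sum_j\rho_j\,\mathrm{Quant}_j(\delta w^j_t)$. **Quantizer.** For $v\in\mathbb R^d$ call $i$ high-resolution if $|v_i|\ge\lambda_j\|v\|_\infty$, and let $q$ be the smallest $|v_i|$ over the high-resolution $i$. Let $Q$ round to the nearest of the $2^{b_j}$ equispaced points from $q$ to $\|v\|_\infty$. Then $\mathrm{Quant}_j(v)_i=\operatorname{sign}(v_i)\,Q(|v_i|)$ if $i$ is high-resolution; otherwise it is $Q(q)/2$ if $v_i>0$ and $-Q(q)/2$ if $v_i\le0$. Put $$c_j=\max\Big\{\tfrac{\lambda_j}{2}+\tfrac{1-\lambda_j}{4(2^{b_j}-1)},\ \tfrac{1-\lambda_j}{2(2^{b_j}-1)}\Big\},\qquad c_{\max}=\max_jc_j .$$ **Assumptions.** Let $\bar L,G>0$ and $\sigma_l,\sigma_g\in\mathbb R$. Every $\nabla f_j$ is $\bar L$-Lipschitz; every coordinate of every sample gradient $\nabla\ell(w;z_{nj})$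 is at most $G$ in absolute value; and for all $w$ and $j$, $\frac1{n_j}\sum_n\|\nabla\ell(w;z_{nj})-\nabla f_j(w)\|^2\le\sigma_l^2$ and $\sum_j\rho_j\|\nabla f_j(w)-\nabla f(w)\|^2\le\sigma_g^2$. The step size satisfies $\alpha\le\min\{(16L\bar L)^{-1},(2L\sqrt{\bar L})^{-1}\}$ and $$\alpha\le\frac1{16L}\min\Big\{\frac1{\bar L},\ T^{-1/6}\Big(\frac1{120\bar L^2G}\Big)^{1/3}\Big\},\qquad \alpha\le\frac1{16L}\min\Big\{T^{-1/10}\Big(\frac1{\bar L^2G^3}\Big)^{1/5},\ T^{-1/8}\Big(\frac1{\bar L^3G}\Big)^{1/4}\Big\}.$$ **Claim.** With $\Delta_f=f(w_0)-f(w^*)$, $\bar\sigma^2=6L\sigma_g^2+\sigma_l^2$ and $$\Phi=2LT\bar\sigma^2+4L^2+Kc_{\max}^2(2L+T\bar\sigma^2)+\frac{\Delta_f}{\alpha},$$ one has $$\min_{1\le t\le T}\mathbb E\|\nabla f(w_t)\|^2\le C\cdot\frac{1+\alpha LG\sqrt T}{\alpha LT}\cdot\Phi,$$ where $C$ depends only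 on $d$, $\bar L$, $\epsilon_a$ and an upper bound on the batch sizes $\xi_j$; in particular $C$ does not depend on $K$, $L$, $T$, $\alpha$, $G$, $\sigma_l$, $\sigma_g$, $\Delta_f$, $\rho_j$, $b_j$ or $\lambda_j$. -/

import Mathlib

open scoped BigOperators

universe u v

noncomputable section

namespace FedAvg

/-- The parameter space `ℝ^d` with the Euclidean norm. -/
abbrev Vec (d : ℕ) : Type := EuclideanSpace ℝ (Fin d)

/-! ### The mixed-resolution quantizer -/

/-- The infinity norm of a vector. -/
def supNorm {d : ℕ} (v : Vec d) : ℝ := ⨆ i, |v i|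

/-- Element `i` of `v` is of high resolution if `|v i| / ‖v‖_∞ ≥ lam`; written without the
division, so that it makes sense for `v = 0`, too. -/
def IsHighRes {d : ℕ} (lam : ℝ) (v : Vec d) (i : Fin d) : Prop := lam * supNorm v ≤ |v i|

/-- The smallest absolute value of a high-resolution element. -/
def minHighRes {d : ℕ} (lam : ℝ) (v : Vec d) : ℝ := ⨅ i : {i // IsHighRes lam v i}, |v i.1|

/-- Uniform quantization with `b` bits on `[lo, hi]`: round to the nearest of the `2 ^ b`
equispaced grid points `lo + k (hi - lo) / (2 ^ b - 1)`, so that the error is at most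
`(hi - lo) / (2 (2 ^ b - 1))`. For `lo = hi` the value is `lo`. -/
def uniformQuant (b : ℕ) (lo hi x : ℝ) : ℝ :=
  lo + (hi - lo) / (2 ^ b - 1) * (round ((x - lo) / ((hi - lo) / (2 ^ b - 1))) : ℝ)

/-- The quantizer applied to magnitudes: the grid spans `[minHighRes, supNorm]`, so its
radius is `‖v‖_∞ - minHighRes`. -/
def magnitudeQuant {d : ℕ} (b : ℕ) (lam : ℝ) (v : Vec d) (x : ℝ) : ℝ :=
  uniformQuant b (minHighRes lam v) (supNorm v) x

open Classical in
/-- The vector that the server reconstructs: high-resolution elements keep their sign and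
have their magnitude uniformly quantized; of the others only the sign is kept (zero counts as
negative), and their magnitude becomes half the quantized value of `minHighRes`. -/
def mixedQuant {d : ℕ} (b : ℕ) (lam : ℝ) (v : Vec d) : Vec d :=
  WithLp.toLp 2 fun i =>
    if IsHighRes lam v i then Real.sign (v i) * magnitudeQuant b lam v |v i|
    else if 0 < v i then magnitudeQuant b lam v (minHighRes lam v) / 2
    else -(magnitudeQuant b lam v (minHighRes lam v) / 2)

/-- The error coefficient `c_j` of the quantizer with `b` bits and threshold `lam`. -/
def errCoeff (b : ℕ) (lam : ℝ) : ℝ :=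
  max (lam / 2 + (1 - lam) / (4 * (2 ^ b - 1))) ((1 - lam) / (2 * (2 ^ b - 1)))

/-! ### The learning problem -/

/-- A federated learning problem with `K` users: user `j` holds `size j` labelled samples,
and `loss w z` is the loss of the model `w` on the labelled sample `z`. -/
structure Problem (d K : ℕ) (X : Type u) (Y : Type v) where
  /-- the number of samples of each user -/
  size : Fin K → ℕ
  /-- the samples of each user -/
  sample : ∀ j, Fin (size j) → X × Y
  /-- the loss of a model on a sample -/
  loss : Vec d → X × Y → ℝ

namespace Problem

variable {d K : ℕ} {X : Type u} {Y : Type v} (P : Problem d K X Y)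

/-- The fraction `ρ_j` of the data that user `j` holds. -/
def weight (j : Fin K) : ℝ := (P.size j : ℝ) / ∑ k, (P.size k : ℝ)

/-- The local loss `f_j`. -/
def localLoss (j : Fin K) (w : Vec d) : ℝ := (∑ n, P.loss w (P.sample j n)) / (P.size j : ℝ)

/-- The global loss `f = ∑ ρ_j f_j`. -/
def globalLoss (w : Vec d) : ℝ := ∑ j, P.weight j * P.localLoss j w

/-- The gradient in `w` of the loss on sample `n` of user `j`. -/
def sampleGrad (j : Fin K) (n : Fin (P.size j)) (w : Vec d) : Vec d :=
  gradient (fun w' => P.loss w' (P.sample j n)) w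

/-- The loss is differentiable in `w` on every sample. -/
def DifferentiableLoss : Prop :=
  ∀ j n, Differentiable ℝ fun w => P.loss w (P.sample j n)

/-- All local losses are `Lbar`-smooth. -/
def Smooth (Lbar : ℝ) : Prop :=
  ∀ j w w', ‖gradient (P.localLoss j) w - gradient (P.localLoss j) w'‖ ≤ Lbar * ‖w - w'‖

/-- The stochastic gradients are bounded by `G` in every coordinate. -/
def GradBounded (G : ℝ) : Prop := ∀ j n w i, |P.sampleGrad j n w i| ≤ G

/-- The local variance (of the gradient on a uniformly random sample of one user) is bounded
by `σl ^ 2`. -/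
def LocalVarBounded (σl : ℝ) : Prop :=
  ∀ j w, (∑ n, ‖P.sampleGrad j n w - gradient (P.localLoss j) w‖ ^ 2) / (P.size j : ℝ) ≤ σl ^ 2

/-- The global variance (of the local gradients, across the users) is bounded by `σg ^ 2`. -/
def GlobalVarBounded (σg : ℝ) : Prop :=
  ∀ w, ∑ j, P.weight j * ‖gradient (P.localLoss j) w - gradient P.globalLoss w‖ ^ 2 ≤ σg ^ 2

end Problem

/-! ### The algorithm -/

/-- The parameters of the algorithm for `K` users. -/
structure Params (d K : ℕ) where
  /-- the initial global model `w_0` -/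
  init : Vec d
  /-- the number of rounds -/
  T : ℕ
  /-- the number of local steps per round -/
  L : ℕ
  /-- the step size -/
  α : ℝ
  /-- the constant under the square root of the local AdaGrad updates -/
  εa : ℝ
  /-- the mini-batch sizes `ξ_j` -/
  batch : Fin K → ℕ
  /-- the numbers `b_j` of bits for the high-resolution elements -/
  bits : Fin K → ℕ
  /-- the magnitude ratio thresholds `λ_j` -/
  lam : Fin K → ℝ

namespace Params

variable {d K : ℕ} {X : Type u} {Y : Type v} (A : Params d K)

/-- The algorithm can be run on the problem `P`: there is at least one round and one local
step, the step size and `εa` are positive, every batch is nonempty and no larger than the data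
set of its user, `b_j ≥ 2`, and the thresholds are ratios. -/
structure Admissible (P : Problem d K X Y) : Prop where
  one_le_T : 1 ≤ A.T
  one_le_L : 1 ≤ A.L
  α_pos : 0 < A.α
  εa_pos : 0 < A.εa
  one_le_batch : ∀ j, 1 ≤ A.batch j
  batch_le : ∀ j, A.batch j ≤ P.size j
  two_le_bits : ∀ j, 2 ≤ A.bits j
  lam_nonneg : ∀ j, 0 ≤ A.lam j
  lam_le_one : ∀ j, A.lam j ≤ 1

/-- `c_max`, the maximum of the error coefficients of the users. -/
def cMax : ℝ := ⨆ j, errCoeff (A.bits j) (A.lam j)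

/-- The sample space of the algorithm: for every round, user and local step a subset of
`ξ_j` samples of that user. Under the uniform distribution on this finite product, all these
mini-batches are independent, each uniform among the subsets of its size. -/
abbrev Batches (P : Problem d K X Y) : Type :=
  ∀ i : Fin A.T × Fin K × Fin A.L, {S : Finset (Fin (P.size i.2.1)) // S.card = A.batch i.2.1}

variable {A} {P : Problem d K X Y}

/-- The mini-batch used by user `j` in local step `h + 1` of round `t + 1`. -/
def miniBatch (ω : A.Batches P) (t : ℕ) (j : Fin K) (h : ℕ) : Finset (Fin (P.size j)) :=
  if H : t < A.T ∧ h < A.L then (ω (⟨t, H.1⟩, j, ⟨h, H.2⟩)).1 else ∅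

/-- The stochastic gradient at `w` of user `j` in local step `h + 1` of round `t + 1`: the sum
of the sample gradients over the mini-batch. -/
def stochGrad (ω : A.Batches P) (t : ℕ) (j : Fin K) (h : ℕ) (w : Vec d) : Vec d :=
  ∑ n ∈ miniBatch ω t j h, P.sampleGrad j n w

/-- The local model and the AdaGrad accumulator of user `j` after `h` local steps of round
`t + 1`, started from the global model `w`. In step `h + 1` the accumulator becomes
`g_1 = 0` if `h = 0`, and otherwise grows by the squared entries of the current stochastic
gradient; the step is then divided entrywise by the square root of accumulator plus `εa`. -/
def localState (ω : A.Batches P) (t : ℕ) (j : Fin K) (w : Vec d) : ℕ → Vec d × (Fin d → ℝ)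
  | 0 => (w, 0)
  | h + 1 =>
    let s := localState ω t j w h
    let grad := stochGrad ω t j h s.1
    let g : Fin d → ℝ := if h = 0 then 0 else fun i => s.2 i + grad i * grad i
    (s.1 - WithLp.toLp 2 (fun i => A.α / √(g i + A.εa) * grad i), g)

/-- The local update `δw` of user `j` in round `t + 1`: final local model minus `w`. -/
def localUpdate (ω : A.Batches P) (t : ℕ) (j : Fin K) (w : Vec d) : Vec d :=
  (localState ω t j w A.L).1 - w

/-- The global model `w_t` after `t` rounds. -/
def globalModel (ω : A.Batches P) : ℕ → Vec d
  | 0 => A.init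
  | t + 1 => globalModel ω t + ∑ j, P.weight j •
      mixedQuant (A.bits j) (A.lam j) (localUpdate ω t j (globalModel ω t))

/-- `E ‖∇f(w_t)‖²`, the expectation over all mini-batches of the algorithm. -/
def expGradSq (A : Params d K) (P : Problem d K X Y) (t : ℕ) : ℝ :=
  𝔼 ω : A.Batches P, ‖gradient P.globalLoss (globalModel ω t)‖ ^ 2

/-- The step size conditions: `α ≤ min {1 / (16 L Lbar), 1 / (2 L √Lbar)}`, and the two
conditions on the local step size in the analysis of adaptive federated optimization, for
server step size `1` and server adaptivity `τ = 1`. -/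
structure StepSizeOK (A : Params d K) (Lbar G : ℝ) : Prop where
  basic : A.α ≤ min (16 * A.L * Lbar)⁻¹ (2 * A.L * √Lbar)⁻¹
  condI : A.α ≤ 1 / (16 * A.L) *
    min (1 / Lbar) (1 / (A.T : ℝ) ^ (1 / 6 : ℝ) * (1 / (120 * Lbar ^ 2 * G)) ^ (1 / 3 : ℝ))
  condII : A.α ≤ 1 / (16 * A.L) *
    min (1 / (A.T : ℝ) ^ (1 / 10 : ℝ) * (1 / (Lbar ^ 2 * G ^ 3)) ^ (1 / 5 : ℝ))
      (1 / (A.T : ℝ) ^ (1 / 8 : ℝ) * (1 / (Lbar ^ 3 * G)) ^ (1 / 4 : ℝ))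

/-- `σ̄² = 6 L σ_g² + σ_l²`. -/
def sigmaBarSq (A : Params d K) (σl σg : ℝ) : ℝ := 6 * A.L * σg ^ 2 + σl ^ 2

/-- `Φ = 2 L T σ̄² + 4 L² + K c_max² (2 L + T σ̄²) + Δ_f / α`. -/
def Phi (A : Params d K) (σl σg Δf : ℝ) : ℝ :=
  2 * A.L * A.T * A.sigmaBarSq σl σg + 4 * (A.L : ℝ) ^ 2
    + K * A.cMax ^ 2 * (2 * A.L + A.T * A.sigmaBarSq σl σg) + A.α⁻¹ * Δf

end Params

end FedAvg

end

namespace FedAvg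

/-! ### The quantizer -/

section Quantizer

variable {d : ℕ}

/-! The quantizer is not treated as a perturbation of size `c_j`. What is used is that, for every
threshold and every bit number at least 2, it preserves signs, never exceeds the sup norm of its
input, and keeps at least a sixth of that norm at any coordinate whose size is at least a third of
it. Hence `C` involves neither `b_j` nor `λ_j`, and the `cMax` term of `Phi` is merely discarded as
nonnegative.

After division by `√εa`, the local update of a user is `-α` times a sum of AdaGrad steps `x k /
√(adaAcc x k + 1)`. The vectors `x k` are compared with the constant vector `g = ξ ∇f(w) / √εa`; let
`A` be the largest `|g i|` and `ω²` the total squared deviation over the `L` steps. If `ω` is below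
`min A (1 + A / L) / (24 d)`, the coordinate with the largest `|g i|` moves at least a third as far
as any other (`abs_adaSum_le_three_mul`), so the quantized update has inner product at most `-A
‖v‖_∞ / 8` with `g` (`sum_mul_mixedQuant_le`). Since the first AdaGrad step is not divided by past
gradients, `‖v‖_∞ ≥ α (A - ω)`, and the progress is of order `α A²`.

If `ω` is larger, progress may fail. The deviation consists of noise (sampling error and
disagreement of the users) and drift of the local model. The drift is bounded by a small multiple of
`min A (1 + A / L) ^ 2 + ω ^ 2`, and in this regime that is a small multiple of `ω²`, so noise
dominates and pays for the loss (`user_progress`). A Young inequality with weight `√T` turns the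
cross term `A L ωn` into `G √T` times noise plus `G L² / √T`. Averaging over users and mini-batches
bounds the noise by `B² L σ̄²`, and the descent inequality telescopes (`sum_expGradSq_succ_le`).
Every resulting term is at most a constant times the claimed right-hand side (`error_terms_le`).

All this needs `α L` and `α² L³` below constants depending on `d`, `Lbar`, `εa` and the batch bound.
If one of them is not, `α³ L⁵` is bounded below (`min_le_of_large_step`). The step size condition
with `T ^ (-1/6)` then makes the right-hand side at least a constant times `G²`
(`sq_le_of_large_step`), and the trivial bound `‖∇f‖² ≤ d G²` suffices. -/

theorem abs_le_supNorm (v : Vec d) (i : Fin d) : |v i| ≤ supNorm v :=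
  le_ciSup (f := fun i => |v i|) (Set.finite_range _).bddAbove i

theorem supNorm_nonneg (v : Vec d) : 0 ≤ supNorm v := Real.iSup_nonneg fun _ => abs_nonneg _

theorem supNorm_le {v : Vec d} {c : ℝ} (hc : 0 ≤ c) (h : ∀ i, |v i| ≤ c) : supNorm v ≤ c :=
  Real.iSup_le h hc

theorem exists_abs_eq_supNorm [Nonempty (Fin d)] (v : Vec d) : ∃ i, |v i| = supNorm v :=
  exists_eq_ciSup_of_finite (f := fun i => |v i|)

theorem minHighRes_nonneg (lam : ℝ) (v : Vec d) : 0 ≤ minHighRes lam v :=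
  Real.iInf_nonneg fun _ => abs_nonneg _

theorem minHighRes_le {lam : ℝ} {v : Vec d} {i : Fin d} (hi : IsHighRes lam v i) :
    minHighRes lam v ≤ |v i| :=
  ciInf_le (f := fun i : {i // IsHighRes lam v i} => |v i.1|) (Set.finite_range _).bddBelow ⟨i, hi⟩

theorem isHighRes_of_abs_eq {lam : ℝ} (h1 : lam ≤ 1) {v : Vec d} {i : Fin d}
    (hi : |v i| = supNorm v) : IsHighRes lam v i := by
  rw [IsHighRes, hi]
  exact mul_le_of_le_one_left (supNorm_nonneg v) h1

theorem minHighRes_le_supNorm [Nonempty (Fin d)] {lam : ℝ} (h1 : lam ≤ 1) (v : Vec d) :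
    minHighRes lam v ≤ supNorm v := by
  obtain ⟨i, hi⟩ := exists_abs_eq_supNorm v
  exact hi ▸ minHighRes_le (isHighRes_of_abs_eq h1 hi)

theorem le_minHighRes [Nonempty (Fin d)] {lam : ℝ} (h1 : lam ≤ 1) (v : Vec d) :
    lam * supNorm v ≤ minHighRes lam v := by
  obtain ⟨i, hi⟩ := exists_abs_eq_supNorm v
  have : Nonempty {i // IsHighRes lam v i} := ⟨⟨i, isHighRes_of_abs_eq h1 hi⟩⟩
  exact le_ciInf fun j => j.2

theorem three_le_two_pow_sub_one {b : ℕ} (hb : 2 ≤ b) : (3 : ℝ) ≤ 2 ^ b - 1 := by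
  have : (2 : ℝ) ^ 2 ≤ 2 ^ b := pow_le_pow_right₀ (by norm_num) hb
  linarith

theorem uniformQuant_left (b : ℕ) (lo hi : ℝ) : uniformQuant b lo hi lo = lo := by
  simp [uniformQuant]

/-- Two bits give at least three grid cells, so half a cell is at most a sixth of the range; this is
the origin of the 6. Both ends of the interval are grid points, so rounding does not leave it. -/
theorem uniformQuant_bounds {b : ℕ} (hb : 2 ≤ b) {lo hi x : ℝ} (h1 : lo ≤ x) (h2 : x ≤ hi) :
    lo ≤ uniformQuant b lo hi x ∧ uniformQuant b lo hi x ≤ hi ∧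
      x - (hi - lo) / 6 ≤ uniformQuant b lo hi x := by
  have hn := three_le_two_pow_sub_one hb
  obtain hlt | heq := (h1.trans h2).lt_or_eq
  swap
  · subst heq
    obtain rfl : x = lo := le_antisymm h2 h1
    simp [uniformQuant_left]
  set n : ℝ := 2 ^ b - 1 with hndef
  have hn0 : 0 < n := by linarith
  set s := (hi - lo) / n with hs
  have hs0 : 0 < s := div_pos (by linarith) hn0
  have hsn : s * n = hi - lo := by rw [hs]; field_simp
  have hs6 : s / 2 ≤ (hi - lo) / 6 := by nlinarith
  set y := (x - lo) / s with hy
  have hsy : s * y = x - lo := by rw [hy]; field_simp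
  have hy0 : 0 ≤ y := div_nonneg (by linarith) hs0.le
  have hyn : y ≤ n := by rw [hy, div_le_iff₀ hs0]; linarith
  have hr := abs_le.1 (abs_sub_round y)
  -- Rounding could overshoot an end by at most 1/2; since both ends `0` and `2 ^ b - 1` are
  -- integers, integrality excludes it.
  have hr0 : (0 : ℤ) ≤ round y := by
    have : (-1 : ℝ) < round y := by linarith
    have : (-1 : ℤ) < round y := by exact_mod_cast this
    omega
  have hrn : (round y : ℝ) ≤ n := by
    have : (round y : ℝ) < 2 ^ b - 1 + 1 := by linarith
    have : round y < 2 ^ b - 1 + 1 := by exact_mod_cast this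
    have : round y ≤ 2 ^ b - 1 := by omega
    have : ((round y : ℤ) : ℝ) ≤ ((2 ^ b - 1 : ℤ) : ℝ) := Int.cast_le.2 this
    rw [hndef]
    push_cast at this
    exact this
  have hr0' : (0 : ℝ) ≤ round y := by exact_mod_cast hr0
  have : uniformQuant b lo hi x = lo + s * round y := rfl
  rw [this]
  refine ⟨by nlinarith, by nlinarith, by nlinarith⟩

theorem magnitudeQuant_minHighRes (b : ℕ) (lam : ℝ) (v : Vec d) :
    magnitudeQuant b lam v (minHighRes lam v) = minHighRes lam v := uniformQuant_left _ _ _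

theorem mixedQuant_apply_of_highRes {b : ℕ} {lam : ℝ} {v : Vec d} {i : Fin d}
    (hi : IsHighRes lam v i) :
    mixedQuant b lam v i = Real.sign (v i) * magnitudeQuant b lam v |v i| := by
  simp [mixedQuant, hi]

theorem mixedQuant_apply_of_pos {b : ℕ} {lam : ℝ} {v : Vec d} {i : Fin d}
    (hi : ¬ IsHighRes lam v i) (hv : 0 < v i) : mixedQuant b lam v i = minHighRes lam v / 2 := by
  simp [mixedQuant, hi, hv, magnitudeQuant_minHighRes]

theorem mixedQuant_apply_of_nonpos {b : ℕ} {lam : ℝ} {v : Vec d} {i : Fin d}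
    (hi : ¬ IsHighRes lam v i) (hv : v i ≤ 0) :
    mixedQuant b lam v i = -(minHighRes lam v / 2) := by
  simp [mixedQuant, hi, hv.not_gt, magnitudeQuant_minHighRes]

theorem abs_mixedQuant_le [Nonempty (Fin d)] {b : ℕ} (hb : 2 ≤ b) {lam : ℝ} (h1 : lam ≤ 1)
    (v : Vec d) (i : Fin d) : |mixedQuant b lam v i| ≤ supNorm v := by
  have hq := minHighRes_nonneg lam v
  have hqs := minHighRes_le_supNorm h1 v
  by_cases hi : IsHighRes lam v i
  · obtain ⟨h2, h3, -⟩ := uniformQuant_bounds hb (minHighRes_le hi) (abs_le_supNorm v i)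
    rw [mixedQuant_apply_of_highRes hi, abs_mul, magnitudeQuant, abs_of_nonneg (hq.trans h2)]
    have : |Real.sign (v i)| ≤ 1 := by
      rcases Real.sign_apply_eq (v i) with h | h | h <;> simp [h]
    nlinarith
  · rcases lt_or_ge 0 (v i) with hv | hv
    · rw [mixedQuant_apply_of_pos hi hv, abs_of_nonneg] <;> linarith
    · rw [mixedQuant_apply_of_nonpos hi hv, abs_neg, abs_of_nonneg] <;> linarith

/-- Signs are kept, and the convention that zero counts as negative is harmless because the product
vanishes there. -/
theorem mul_mixedQuant_nonneg {b : ℕ} (hb : 2 ≤ b) {lam : ℝ} (v : Vec d) (i : Fin d) :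
    0 ≤ v i * mixedQuant b lam v i := by
  have hq := minHighRes_nonneg lam v
  by_cases hi : IsHighRes lam v i
  · obtain ⟨h2, h3, -⟩ := uniformQuant_bounds hb (minHighRes_le hi) (abs_le_supNorm v i)
    rw [mixedQuant_apply_of_highRes hi, ← mul_assoc, magnitudeQuant]
    refine mul_nonneg ?_ (hq.trans h2)
    rw [mul_comm]
    exact Real.sign_mul_nonneg _
  · rcases lt_or_ge 0 (v i) with hv | hv
    · rw [mixedQuant_apply_of_pos hi hv]; positivity
    · rw [mixedQuant_apply_of_nonpos hi hv]; nlinarith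

/-- A high-resolution entry of size at least `‖v‖_∞ / 3` loses at most `‖v‖_∞ / 6`. A low-resolution
entry of that size forces `lam > 1/3` (unless `v = 0`), so half of `minHighRes` is still at least
`lam ‖v‖_∞ / 2 ≥ ‖v‖_∞ / 6`. -/
theorem le_abs_mixedQuant [Nonempty (Fin d)] {b : ℕ} (hb : 2 ≤ b) {lam : ℝ}
    (h1 : lam ≤ 1) {v : Vec d} {i : Fin d} (hv : supNorm v ≤ 3 * |v i|) :
    supNorm v / 6 ≤ |mixedQuant b lam v i| := by
  have hq := minHighRes_nonneg lam v
  have hqs := minHighRes_le_supNorm h1 v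
  have hs := supNorm_nonneg v
  by_cases hi : IsHighRes lam v i
  · obtain ⟨h2, h3, h4⟩ := uniformQuant_bounds hb (minHighRes_le hi) (abs_le_supNorm v i)
    rw [mixedQuant_apply_of_highRes hi, abs_mul, magnitudeQuant, abs_of_nonneg (hq.trans h2)]
    by_cases h0 : v i = 0
    · rw [h0, abs_zero, mul_zero] at hv
      have : supNorm v = 0 := le_antisymm hv hs
      rw [this]
      have := hq.trans h2
      rw [‹supNorm v = 0›] at this
      simp only [zero_div]
      positivity
    · have : |Real.sign (v i)| = 1 := by
        rcases lt_or_gt_of_ne h0 with h | h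
        · simp [Real.sign_of_neg h]
        · simp [Real.sign_of_pos h]
      rw [this]
      linarith
  · have hl := le_minHighRes h1 v
    have : |v i| < lam * supNorm v := not_le.1 hi
    have : |mixedQuant b lam v i| = minHighRes lam v / 2 := by
      rcases lt_or_ge 0 (v i) with hv | hv
      · rw [mixedQuant_apply_of_pos hi hv, abs_of_nonneg (by linarith)]
      · rw [mixedQuant_apply_of_nonpos hi hv, abs_neg, abs_of_nonneg (by linarith)]
    linarith

end Quantizer

/-! ### Sums of AdaGrad steps in one coordinate -/

section AdaGrad

/-- The accumulator of AdaGrad, which skips the gradient of the first step. -/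
noncomputable def adaAcc (x : ℕ → ℝ) (h : ℕ) : ℝ := ∑ k ∈ Finset.Ico 1 (h + 1), x k ^ 2

/-- The sum of the first `h` normalized AdaGrad steps. -/
noncomputable def adaSum (x : ℕ → ℝ) (h : ℕ) : ℝ := ∑ k ∈ Finset.range h, x k / √(adaAcc x k + 1)

variable {x y : ℕ → ℝ} {L h : ℕ} {a b A ω : ℝ}

theorem adaAcc_nonneg (x : ℕ → ℝ) (h : ℕ) : 0 ≤ adaAcc x h :=
  Finset.sum_nonneg fun _ _ => sq_nonneg _

theorem adaAcc_zero (x : ℕ → ℝ) : adaAcc x 0 = 0 := by simp [adaAcc]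

theorem adaAcc_succ (x : ℕ → ℝ) (h : ℕ) : adaAcc x (h + 1) = adaAcc x h + x (h + 1) ^ 2 :=
  Finset.sum_Ico_succ_top (by omega) _

theorem one_le_sqrt_adaAcc (x : ℕ → ℝ) (h : ℕ) : 1 ≤ √(adaAcc x h + 1) :=
  Real.one_le_sqrt.2 (by linarith [adaAcc_nonneg x h])

theorem adaSum_neg (x : ℕ → ℝ) (h : ℕ) : adaSum (fun k => -x k) h = -adaSum x h := by
  simp [adaSum, adaAcc, neg_div]

theorem abs_step_le (x : ℕ → ℝ) (k : ℕ) : |x k / √(adaAcc x k + 1)| ≤ |x k| := by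
  rw [abs_div, abs_of_pos (zero_lt_one.trans_le (one_le_sqrt_adaAcc x k))]
  exact div_le_self (abs_nonneg _) (one_le_sqrt_adaAcc x k)

/-- For `k ≥ 1` the accumulator already contains `x k ^ 2`. This fails for `k = 0`, the step that is
not normalized. -/
theorem abs_step_le_one (x : ℕ → ℝ) {k : ℕ} (hk : 1 ≤ k) : |x k / √(adaAcc x k + 1)| ≤ 1 := by
  have h1 := one_le_sqrt_adaAcc x k
  rw [abs_div, abs_of_pos (zero_lt_one.trans_le h1), div_le_one (by linarith)]
  refine Real.abs_le_sqrt ?_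
  have : x k ^ 2 ≤ adaAcc x k :=
    Finset.single_le_sum (f := fun k => x k ^ 2) (fun _ _ => sq_nonneg _)
      (Finset.mem_Ico.2 ⟨hk, by omega⟩)
  linarith

theorem abs_sub_le_of_energy (hω0 : 0 ≤ ω)
    (hω : ∑ k ∈ Finset.range L, (x k - a) ^ 2 ≤ ω ^ 2) {k : ℕ} (hk : k < L) : |x k - a| ≤ ω := by
  refine abs_le_of_sq_le_sq ?_ hω0
  exact (Finset.single_le_sum (f := fun k => (x k - a) ^ 2) (fun _ _ => sq_nonneg _)
      (Finset.mem_range.2 hk)).trans hω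

theorem sum_abs_sub_le_of_energy (hω0 : 0 ≤ ω)
    (hω : ∑ k ∈ Finset.range L, (x k - a) ^ 2 ≤ ω ^ 2) :
    ∑ k ∈ Finset.range L, |x k - a| ≤ √L * ω := by
  have h1 := sq_sum_le_card_mul_sum_sq (s := Finset.range L) (f := fun k => |x k - a|)
  simp only [Finset.card_range, sq_abs] at h1
  refine (le_abs_self _).trans (abs_le_of_sq_le_sq ?_ (by positivity))
  rw [mul_pow, Real.sq_sqrt (Nat.cast_nonneg _)]
  exact h1.trans (by gcongr)

theorem abs_adaSum_le_mul (hω0 : 0 ≤ ω) (hω : ∑ k ∈ Finset.range L, (x k - a) ^ 2 ≤ ω ^ 2)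
    (ha : |a| ≤ A) (hh : h ≤ L) : |adaSum x h| ≤ L * A + √L * ω := by
  have h1 : |adaSum x h| ≤ ∑ k ∈ Finset.range L, |x k| := by
    refine (Finset.abs_sum_le_sum_abs _ _).trans ?_
    refine (Finset.sum_le_sum fun k _ => abs_step_le x k).trans ?_
    exact Finset.sum_le_sum_of_subset_of_nonneg (Finset.range_mono hh) fun _ _ _ => abs_nonneg _
  have h2 : ∑ k ∈ Finset.range L, |x k| ≤ ∑ k ∈ Finset.range L, (A + |x k - a|) := by
    refine Finset.sum_le_sum fun k _ => ?_
    have := abs_add_le a (x k - a)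
    rw [add_sub_cancel] at this
    linarith
  rw [Finset.sum_add_distrib] at h2
  simp only [Finset.sum_const, Finset.card_range, nsmul_eq_mul] at h2
  linarith [sum_abs_sub_le_of_energy hω0 hω]

/-- The first step is at most `A + ω`, and each of the others is at most 1. This beats the bound `L
* A + √L * ω` when gradients are large. -/
theorem abs_adaSum_le_add (hL : 1 ≤ L) (hω0 : 0 ≤ ω)
    (hω : ∑ k ∈ Finset.range L, (x k - a) ^ 2 ≤ ω ^ 2) (ha : |a| ≤ A) (hh : h ≤ L) :
    |adaSum x h| ≤ A + ω + L := by
  have hA : 0 ≤ A := (abs_nonneg a).trans ha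
  have h1 : |adaSum x h| ≤ ∑ k ∈ Finset.range L, |x k / √(adaAcc x k + 1)| := by
    refine (Finset.abs_sum_le_sum_abs _ _).trans ?_
    exact Finset.sum_le_sum_of_subset_of_nonneg (Finset.range_mono hh) fun _ _ _ => abs_nonneg _
  obtain ⟨n, rfl⟩ : ∃ n, L = n + 1 := ⟨L - 1, by omega⟩
  rw [Finset.sum_range_succ'] at h1
  have h2 : ∑ k ∈ Finset.range n, |x (k + 1) / √(adaAcc x (k + 1) + 1)| ≤ n := by
    refine (Finset.sum_le_sum fun k _ => abs_step_le_one x (k := k + 1) (by omega)).trans ?_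
    simp
  have h3 := abs_step_le x 0
  have h4 := abs_sub_le_of_energy hω0 hω (k := 0) (by omega)
  have h5 := abs_add_le a (x 0 - a)
  rw [add_sub_cancel] at h5
  push_cast
  linarith

/-- All `x k` are positive, so no step cancels another, and the undivided first step alone
contributes at least `a - ω`. -/
theorem le_adaSum_of_lt (hL : 1 ≤ L) (hω0 : 0 ≤ ω)
    (hω : ∑ k ∈ Finset.range L, (x k - a) ^ 2 ≤ ω ^ 2) (ha : ω < a) : a - ω ≤ adaSum x L := by
  have hx : ∀ k < L, a - ω ≤ x k := fun k hk => by
    linarith [(abs_le.1 (abs_sub_le_of_energy hω0 hω hk)).1]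
  have h1 : x 0 / √(adaAcc x 0 + 1) ≤ adaSum x L := by
    refine Finset.single_le_sum (f := fun k => x k / √(adaAcc x k + 1)) (fun k hk => ?_)
      (Finset.mem_range.2 (by omega))
    exact div_nonneg (by linarith [hx k (Finset.mem_range.1 hk)]) (Real.sqrt_nonneg _)
  rw [adaAcc_zero] at h1
  simp only [zero_add, Real.sqrt_one, div_one] at h1
  linarith [hx 0 (by omega)]

theorem energy_neg (hω : ∑ k ∈ Finset.range L, (x k - a) ^ 2 ≤ ω ^ 2) :
    ∑ k ∈ Finset.range L, (-x k - -a) ^ 2 ≤ ω ^ 2 := by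
  refine le_trans (le_of_eq ?_) hω
  exact Finset.sum_congr rfl fun k _ => by ring

theorem mul_adaSum_pos (hL : 1 ≤ L) (hω0 : 0 ≤ ω)
    (hω : ∑ k ∈ Finset.range L, (x k - a) ^ 2 ≤ ω ^ 2) (ha : ω < |a|) : 0 < a * adaSum x L := by
  rcases le_or_gt 0 a with h | h
  · rw [abs_of_nonneg h] at ha
    exact mul_pos (hω0.trans_lt ha) (by linarith [le_adaSum_of_lt hL hω0 hω ha])
  · rw [abs_of_neg h] at ha
    have := le_adaSum_of_lt hL hω0 (energy_neg hω) ha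
    rw [adaSum_neg] at this
    nlinarith

theorem sub_le_abs_adaSum (hL : 1 ≤ L) (hω0 : 0 ≤ ω)
    (hω : ∑ k ∈ Finset.range L, (x k - a) ^ 2 ≤ ω ^ 2) : |a| - ω ≤ |adaSum x L| := by
  rcases le_or_gt |a| ω with h0 | ha
  · linarith [abs_nonneg (adaSum x L)]
  rcases le_or_gt 0 a with h | h
  · rw [abs_of_nonneg h] at ha ⊢
    exact (le_adaSum_of_lt hL hω0 hω ha).trans (le_abs_self _)
  · rw [abs_of_neg h] at ha ⊢
    have := le_adaSum_of_lt hL hω0 (energy_neg hω) ha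
    rw [adaSum_neg] at this
    exact this.trans (neg_le_abs _)

/-! ### Comparison with AdaGrad on a constant gradient -/

theorem mul_sq_le_adaAcc (hω : ∑ k ∈ Finset.range L, (x k - a) ^ 2 ≤ ω ^ 2) (hh : h < L) :
    h * a ^ 2 ≤ 5 / 4 * adaAcc x h + 5 * ω ^ 2 := by
  have h1 : ∑ k ∈ Finset.Ico 1 (h + 1), (x k - a) ^ 2 ≤ ω ^ 2 := by
    refine le_trans (Finset.sum_le_sum_of_subset_of_nonneg ?_ fun _ _ _ => sq_nonneg _) hω
    intro k; simp only [Finset.mem_Ico, Finset.mem_range]; omega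
  have h2 : ∑ k ∈ Finset.Ico 1 (h + 1), a ^ 2
      ≤ ∑ k ∈ Finset.Ico 1 (h + 1), (5 / 4 * x k ^ 2 + 5 * (x k - a) ^ 2) :=
    Finset.sum_le_sum fun k _ => by nlinarith [sq_nonneg (5 * x k - 4 * a)]
  rw [Finset.sum_add_distrib, ← Finset.mul_sum, ← Finset.mul_sum] at h2
  simp only [Finset.sum_const, Nat.card_Ico, nsmul_eq_mul, Nat.add_sub_cancel] at h2
  unfold adaAcc
  linarith

theorem adaAcc_le_mul_sq (hω : ∑ k ∈ Finset.range L, (x k - a) ^ 2 ≤ ω ^ 2) (hh : h < L) :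
    adaAcc x h ≤ 5 / 4 * (h * a ^ 2) + 5 * ω ^ 2 := by
  have h1 : ∑ k ∈ Finset.Ico 1 (h + 1), (x k - a) ^ 2 ≤ ω ^ 2 := by
    refine le_trans (Finset.sum_le_sum_of_subset_of_nonneg ?_ fun _ _ _ => sq_nonneg _) hω
    intro k; simp only [Finset.mem_Ico, Finset.mem_range]; omega
  have h2 : adaAcc x h
      ≤ ∑ k ∈ Finset.Ico 1 (h + 1), (5 / 4 * a ^ 2 + 5 * (x k - a) ^ 2) :=
    Finset.sum_le_sum fun k _ => by nlinarith [sq_nonneg (5 * a - 4 * x k)]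
  rw [Finset.sum_add_distrib, ← Finset.mul_sum _ _ (5 : ℝ)] at h2
  simp only [Finset.sum_const, Nat.card_Ico, nsmul_eq_mul, Nat.add_sub_cancel] at h2
  linarith

/-- The sum of the AdaGrad steps for the constant gradient `A`. -/
noncomputable def constSum (A : ℝ) (L : ℕ) : ℝ := ∑ k ∈ Finset.range L, A / √(k * A ^ 2 + 1)

theorem div_sqrt_mono {c z A : ℝ} (hc : 0 ≤ c) (hz : 0 ≤ z) (hzA : z ≤ A) :
    z / √(c * z ^ 2 + 1) ≤ A / √(c * A ^ 2 + 1) := by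
  have h1 : 0 < c * z ^ 2 + 1 := by positivity
  have h2 : 0 < c * A ^ 2 + 1 := by positivity
  rw [div_le_div_iff₀ (Real.sqrt_pos.2 h1) (Real.sqrt_pos.2 h2)]
  refine (le_abs_self _).trans (abs_le_of_sq_le_sq ?_ (by have := hz.trans hzA; positivity))
  rw [mul_pow, mul_pow, Real.sq_sqrt h1.le, Real.sq_sqrt h2.le]
  nlinarith [pow_le_pow_left₀ hz hzA 2]

/-- The steps are monotone in `A`, so `A` may be lowered to `min A 1`; then every denominator is at
most `√(2 L)`. The bound lets `√L * ω` be absorbed into `constSum`. -/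
theorem sqrt_mul_min_le_constSum (hL : 1 ≤ L) (hA : 0 ≤ A) : √L * min A 1 ≤ √2 * constSum A L := by
  have hL' : (1 : ℝ) ≤ L := by exact_mod_cast hL
  set z := min A 1
  have hz0 : 0 ≤ z := le_min hA zero_le_one
  have hz1 : z ≤ 1 := min_le_right _ _
  have h1 : ∑ k ∈ Finset.range L, z / (√2 * √L) ≤ constSum A L := by
    refine Finset.sum_le_sum fun k hk => ?_
    have hk' : (k : ℝ) + 1 ≤ L := by exact_mod_cast Finset.mem_range.1 hk
    refine le_trans ?_ (div_sqrt_mono (Nat.cast_nonneg k) hz0 (min_le_left A 1))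
    refine div_le_div_of_nonneg_left hz0 (by positivity) ?_
    rw [← Real.sqrt_mul (by norm_num)]
    refine Real.sqrt_le_sqrt ?_
    have : z ^ 2 ≤ 1 := by nlinarith
    nlinarith [Nat.cast_nonneg (α := ℝ) k]
  simp only [Finset.sum_const, Finset.card_range, nsmul_eq_mul] at h1
  have h2 : √2 * ((L : ℝ) * (z / (√2 * √L))) = √L * z := by
    have hsq : √(L : ℝ) ^ 2 = L := Real.sq_sqrt (by linarith)
    have h3 : √(L : ℝ) ≠ 0 := by positivity
    have h4 : √(2 : ℝ) ≠ 0 := by positivity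
    field_simp
    rw [hsq, mul_comm]
  rw [← h2]
  gcongr

/-- Since `5 ω² ≤ 1/4`, the accumulator satisfies `k a² + 1 ≤ 5/4 (adaAcc x k + 1)`, so replacing it
by that of the constant gradient costs at most a factor `5/4`. The deviations of the numerators add
up to at most `√L ω`. -/
theorem abs_adaSum_le_constSum (hω0 : 0 ≤ ω)
    (hω : ∑ k ∈ Finset.range L, (x k - a) ^ 2 ≤ ω ^ 2) (hω1 : ω ^ 2 ≤ 1 / 20) (ha : |a| ≤ A) :
    |adaSum x L| ≤ 5 / 4 * constSum A L + √L * ω := by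
  have hA : 0 ≤ A := (abs_nonneg a).trans ha
  refine (Finset.abs_sum_le_sum_abs _ _).trans ?_
  have h1 : ∀ k ∈ Finset.range L,
      |x k / √(adaAcc x k + 1)| ≤ 5 / 4 * (A / √(k * A ^ 2 + 1)) + |x k - a| := by
    intro k hk
    have h2 := mul_sq_le_adaAcc hω (Finset.mem_range.1 hk)
    have h3 := one_le_sqrt_adaAcc x k
    rw [abs_div, abs_of_pos (zero_lt_one.trans_le h3)]
    have h4 : |x k| ≤ |a| + |x k - a| := by
      have := abs_add_le a (x k - a)
      rwa [add_sub_cancel] at this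
    have h5 : |x k - a| / √(adaAcc x k + 1) ≤ |x k - a| := div_le_self (abs_nonneg _) h3
    have h6 : |a| / √(adaAcc x k + 1) ≤ 5 / 4 * (|a| / √(k * |a| ^ 2 + 1)) := by
      rw [mul_div_assoc', div_le_div_iff₀ (by linarith) (Real.sqrt_pos.2 (by positivity)),
        mul_assoc, mul_left_comm]
      refine mul_le_mul_of_nonneg_left ?_ (abs_nonneg a)
      rw [← Real.sqrt_sq (show (0 : ℝ) ≤ 5 / 4 by norm_num), ← Real.sqrt_mul (by norm_num)]
      refine Real.sqrt_le_sqrt ?_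
      rw [sq_abs]
      nlinarith [adaAcc_nonneg x k]
    calc |x k| / √(adaAcc x k + 1) ≤ (|a| + |x k - a|) / √(adaAcc x k + 1) := by gcongr
      _ ≤ 5 / 4 * (|a| / √(k * |a| ^ 2 + 1)) + |x k - a| := by rw [add_div]; exact add_le_add h6 h5
      _ ≤ _ := by
        have := div_sqrt_mono (Nat.cast_nonneg k) (abs_nonneg a) ha
        gcongr
  refine (Finset.sum_le_sum h1).trans ?_
  rw [Finset.sum_add_distrib, ← Finset.mul_sum]
  exact add_le_add_right (sum_abs_sub_le_of_energy hω0 hω) _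

/-- Numerators are at least `23/24 a`, and the denominators grow by at most `√(5/4) ≤ 23/18`; the
quotient of these constants is `3/4`. -/
theorem constSum_le_adaSum (hω0 : 0 ≤ ω)
    (hω : ∑ k ∈ Finset.range L, (x k - a) ^ 2 ≤ ω ^ 2) (hω1 : ω ^ 2 ≤ 1 / 20) (ha : 0 ≤ a)
    (hωa : ω ≤ a / 24) : 3 / 4 * constSum a L ≤ adaSum x L := by
  rw [constSum, Finset.mul_sum]
  refine Finset.sum_le_sum fun k hk => ?_
  have h2 := adaAcc_le_mul_sq hω (Finset.mem_range.1 hk)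
  have h3 := one_le_sqrt_adaAcc x k
  have h4 := (abs_le.1 (abs_sub_le_of_energy hω0 hω (Finset.mem_range.1 hk))).1
  have h5 : 23 / 24 * a ≤ x k := by linarith
  rw [mul_div_assoc', div_le_div_iff₀ (Real.sqrt_pos.2 (by positivity)) (by linarith)]
  have h6 : √(adaAcc x k + 1) ≤ 23 / 18 * √(k * a ^ 2 + 1) := by
    rw [← Real.sqrt_sq (show (0 : ℝ) ≤ 23 / 18 by norm_num), ← Real.sqrt_mul (by norm_num)]
    refine Real.sqrt_le_sqrt ?_
    nlinarith [show (0 : ℝ) ≤ k * a ^ 2 by positivity]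
  calc 3 / 4 * a * √(adaAcc x k + 1) ≤ 3 / 4 * a * (23 / 18 * √(k * a ^ 2 + 1)) := by gcongr
    _ = 23 / 24 * a * √(k * a ^ 2 + 1) := by ring
    _ ≤ _ := by gcongr

theorem constSum_le_abs_adaSum (hω0 : 0 ≤ ω)
    (hω : ∑ k ∈ Finset.range L, (x k - a) ^ 2 ≤ ω ^ 2) (hω1 : ω ^ 2 ≤ 1 / 20)
    (hωa : ω ≤ |a| / 24) : 3 / 4 * constSum |a| L ≤ |adaSum x L| := by
  rcases le_or_gt 0 a with h | h
  · rw [abs_of_nonneg h] at hωa ⊢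
    exact (constSum_le_adaSum hω0 hω hω1 h hωa).trans (le_abs_self _)
  · rw [abs_of_neg h] at hωa ⊢
    have := constSum_le_adaSum hω0 (energy_neg hω) hω1 (by linarith) hωa
    rw [adaSum_neg] at this
    exact this.trans (neg_le_abs _)

/-- If the gradients of two coordinates are nearly constant, then the coordinate with the
larger gradient moves at least a third as far as the other one. -/
theorem abs_adaSum_le_three_mul (hL : 1 ≤ L) (hω0 : 0 ≤ ω)
    (hx : ∑ k ∈ Finset.range L, (x k - a) ^ 2 ≤ ω ^ 2)
    (hy : ∑ k ∈ Finset.range L, (y k - b) ^ 2 ≤ ω ^ 2) (hab : |a| ≤ |b|)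
    (h1 : ω ≤ |b| / 24) (h2 : ω ≤ (1 + |b| / L) / 24) : |adaSum x L| ≤ 3 * |adaSum y L| := by
  have hL' : (1 : ℝ) ≤ L := by exact_mod_cast hL
  set A := |b| with hA
  have hA0 : 0 ≤ A := abs_nonneg b
  -- For `A ≤ L` both sums are compared with `constSum A L`. For `A ≥ L` the first step dominates:
  -- one coordinate moves at most `2 A + ω`, the other at least `A - ω`.
  rcases le_total A L with hAL | hAL
  · have h3 : A / L ≤ 1 := (div_le_one (by linarith)).2 hAL
    have hω1 : ω ^ 2 ≤ 1 / 20 := by nlinarith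
    have h4 := abs_adaSum_le_constSum hω0 hx hω1 hab
    have h5 := constSum_le_abs_adaSum hω0 hy hω1 h1
    have h6 := sqrt_mul_min_le_constSum hL hA0
    have h7 : ω ≤ min A 1 / 12 := by
      rcases min_choice A 1 with h | h <;> rw [h] <;> linarith
    have h8 : √L * ω ≤ √L * (min A 1 / 12) := by gcongr
    have h9 : √(2 : ℝ) ≤ 2 := Real.sqrt_le_iff.2 ⟨by norm_num, by norm_num⟩
    have h10 : 0 ≤ constSum A L := Finset.sum_nonneg fun k _ => by positivity
    nlinarith
  · have h3 := abs_adaSum_le_add hL hω0 hx hab le_rfl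
    have h4 := sub_le_abs_adaSum hL hω0 hy
    linarith

end AdaGrad

/-! ### Progress made by the quantized update of one user -/

section UserStep

variable {d L : ℕ} {x : ℕ → Fin d → ℝ} {g : Fin d → ℝ} {A ω α : ℝ} {v : Vec d} {i₀ : Fin d}
  {b : ℕ} {lam : ℝ}

theorem energy_apply (hω : ∑ k ∈ Finset.range L, ∑ i, (x k i - g i) ^ 2 ≤ ω ^ 2) (i : Fin d) :
    ∑ k ∈ Finset.range L, (x k i - g i) ^ 2 ≤ ω ^ 2 :=
  (Finset.sum_le_sum fun k _ => Finset.single_le_sum (f := fun i => (x k i - g i) ^ 2)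
    (fun _ _ => sq_nonneg _) (Finset.mem_univ i)).trans hω

theorem supNorm_update_le_mul (hα : 0 < α) (hω0 : 0 ≤ ω)
    (hω : ∑ k ∈ Finset.range L, ∑ i, (x k i - g i) ^ 2 ≤ ω ^ 2) (hA0 : 0 ≤ A)
    (hA : ∀ i, |g i| ≤ A) (hv : ∀ i, v i = -(α * adaSum (fun k => x k i) L)) :
    supNorm v ≤ α * (L * A + √L * ω) := by
  refine supNorm_le (by positivity) fun i => ?_
  rw [hv, abs_neg, abs_mul, abs_of_pos hα]
  gcongr
  exact abs_adaSum_le_mul hω0 (energy_apply hω i) (hA i) le_rfl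

theorem supNorm_update_le_add (hL : 1 ≤ L) (hα : 0 < α) (hω0 : 0 ≤ ω)
    (hω : ∑ k ∈ Finset.range L, ∑ i, (x k i - g i) ^ 2 ≤ ω ^ 2) (hA0 : 0 ≤ A)
    (hA : ∀ i, |g i| ≤ A) (hv : ∀ i, v i = -(α * adaSum (fun k => x k i) L)) :
    supNorm v ≤ α * (A + ω + L) := by
  refine supNorm_le (by positivity) fun i => ?_
  rw [hv, abs_neg, abs_mul, abs_of_pos hα]
  gcongr
  exact abs_adaSum_le_add hL hω0 (energy_apply hω i) (hA i) le_rfl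

theorem le_supNorm_update (hL : 1 ≤ L) (hα : 0 < α) (hω0 : 0 ≤ ω)
    (hω : ∑ k ∈ Finset.range L, ∑ i, (x k i - g i) ^ 2 ≤ ω ^ 2)
    (hi₀ : |g i₀| = A) (hv : ∀ i, v i = -(α * adaSum (fun k => x k i) L)) :
    α * (A - ω) ≤ supNorm v := by
  refine le_trans ?_ (abs_le_supNorm v i₀)
  rw [hv, abs_neg, abs_mul, abs_of_pos hα]
  gcongr
  rw [← hi₀]
  exact sub_le_abs_adaSum hL hω0 (energy_apply hω i₀)

/-- When `|g i|` exceeds `ω`, no gradient along the local steps can reverse the sign of `g i`, so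
the update and its quantization point against it. -/
theorem mul_mixedQuant_nonpos (hL : 1 ≤ L) (hα : 0 < α) (hω0 : 0 ≤ ω)
    (hω : ∑ k ∈ Finset.range L, ∑ i, (x k i - g i) ^ 2 ≤ ω ^ 2)
    (hv : ∀ i, v i = -(α * adaSum (fun k => x k i) L)) (hb : 2 ≤ b) {i : Fin d}
    (hi : ω < |g i|) : g i * mixedQuant b lam v i ≤ 0 := by
  have h1 := mul_adaSum_pos hL hω0 (energy_apply hω i) hi
  have h2 := mul_mixedQuant_nonneg hb (lam := lam) v i
  rw [hv] at h2
  have h3 : adaSum (fun k => x k i) L * mixedQuant b lam v i ≤ 0 := by nlinarith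
  by_contra! h4
  have h5 := mul_pos h1 h4
  have h6 : 0 < g i ^ 2 := by
    refine lt_of_le_of_ne (sq_nonneg _) fun h => ?_
    have : g i = 0 := by simpa using h.symm
    simp [this] at h4
  nlinarith

/-- If the gradients along the local steps stay close to `g`, then the quantized update is
well aligned with `-g`. -/
theorem sum_mul_mixedQuant_le [Nonempty (Fin d)] (hL : 1 ≤ L) (hα : 0 < α) (hω0 : 0 ≤ ω)
    (hω : ∑ k ∈ Finset.range L, ∑ i, (x k i - g i) ^ 2 ≤ ω ^ 2)
    (hA : ∀ i, |g i| ≤ A) (hi₀ : |g i₀| = A) (hv : ∀ i, v i = -(α * adaSum (fun k => x k i) L))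
    (hb : 2 ≤ b) (h1 : lam ≤ 1) (hd : (1 : ℝ) ≤ d) (hωA : ω * (24 * d) ≤ A)
    (hωL : ω * (24 * d) ≤ 1 + A / L) :
    ∑ i, g i * mixedQuant b lam v i ≤ -(A * supNorm v / 8) := by
  have hA0 : 0 ≤ A := hi₀ ▸ abs_nonneg _
  have hm := supNorm_nonneg v
  rcases hA0.eq_or_lt with h0 | h0
  · subst h0
    have : ∀ i, g i = 0 := fun i => abs_nonpos_iff.1 (hA i)
    simp [this]
  have hω1 : ω * 24 ≤ ω * (24 * d) := by nlinarith
  have hlarge : supNorm v ≤ 3 * |v i₀| := by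
    obtain ⟨i, hi⟩ := exists_abs_eq_supNorm v
    rw [← hi, hv, hv, abs_neg, abs_neg, abs_mul, abs_mul, mul_left_comm]
    gcongr
    refine abs_adaSum_le_three_mul hL hω0 (energy_apply hω i) (energy_apply hω i₀)
      (by rw [hi₀]; exact hA i) ?_ ?_ <;> rw [hi₀] <;> linarith
  -- The largest coordinate gains `A ‖v‖_∞ / 6`. Wrong signs occur only where `|g i| ≤ ω ≤ A / (24
  -- d)`, costing at most `A ‖v‖_∞ / 24` over all coordinates; `1/6 - 1/24 = 1/8`.
  have hterm : ∀ i, g i * mixedQuant b lam v i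
      ≤ (if i = i₀ then -(A * supNorm v / 6) else 0) + A / (24 * d) * supNorm v := by
    intro i
    have hp : 0 ≤ A / (24 * d) * supNorm v := by positivity
    by_cases hgi : ω < |g i|
    · have h2 := mul_mixedQuant_nonpos hL hα hω0 hω hv hb (lam := lam) hgi
      split_ifs with h
      · subst h
        have h3 := le_abs_mixedQuant hb h1 hlarge
        have h4 : |g i * mixedQuant b lam v i| = A * |mixedQuant b lam v i| := by
          rw [abs_mul, hi₀]
        rw [abs_of_nonpos h2] at h4
        nlinarith
      · linarith
    · have h2 : i ≠ i₀ := by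
        rintro rfl
        apply hgi
        rw [hi₀]
        nlinarith
      rw [if_neg h2, zero_add]
      refine (le_abs_self _).trans ?_
      rw [abs_mul]
      refine mul_le_mul ?_ (abs_mixedQuant_le hb h1 v i) (abs_nonneg _) (by positivity)
      rw [le_div_iff₀ (by positivity)]
      nlinarith
  refine (Finset.sum_le_sum fun i _ => hterm i).trans (le_of_eq ?_)
  rw [Finset.sum_add_distrib]
  simp only [Finset.sum_ite_eq', Finset.mem_univ, if_true, Finset.sum_const, Finset.card_univ,
    Fintype.card_fin, nsmul_eq_mul]
  field_simp
  ring

theorem sum_mul_mixedQuant_le_mul [Nonempty (Fin d)] (hA : ∀ i, |g i| ≤ A) (hb : 2 ≤ b)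
    (h1 : lam ≤ 1) : ∑ i, g i * mixedQuant b lam v i ≤ d * (A * supNorm v) := by
  have : ∀ i ∈ Finset.univ, g i * mixedQuant b lam v i ≤ A * supNorm v := fun i _ => by
    refine (le_abs_self _).trans ?_
    rw [abs_mul]
    exact mul_le_mul (hA i) (abs_mixedQuant_le hb h1 v i) (abs_nonneg _)
      ((abs_nonneg _).trans (hA i))
  refine (Finset.sum_le_sum this).trans (le_of_eq ?_)
  simp

/-- Here `ℓ` is the number of steps, `s` its root, `r = ω / s`, and `m` the sup norm of the update.
Large `ω` means `A ≤ 24 D ω` or `ℓ + A ≤ 24 D ℓ ω`. The multiplicative bound on `m` serves the first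
case, the additive one the second; both yield the cross term `A ℓ ω`. -/
theorem update_bounds_of_large_energy {D ℓ s r m A ω α : ℝ} (hD : 1 ≤ D) (hL' : 1 ≤ ℓ)
    (hA0 : 0 ≤ A) (hα : 0 < α) (hω0 : 0 ≤ ω) (hr0 : 0 ≤ r) (hm0 : 0 ≤ m) (hsL : s * s = ℓ)
    (hrs : s * r = ω) (hrω : r ≤ ω) (hmr : m ≤ α * (ℓ * (A + r))) (hm2 : m ≤ α * (A + ω + ℓ))
    (hgood : min A (1 + A / ℓ) < ω * (24 * D)) :
    (A + r) * m ≤ α * (96 * D * (A * ℓ * ω) + 2 * ω ^ 2) ∧ A ^ 2 ≤ 24 * D * (A * ℓ * ω) := by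
  by_cases hA24 : A ≤ 24 * D * ω
  · have h9 : A * A ≤ A * (24 * D * ω) := by gcongr
    have h10 : A * (24 * D * ω) ≤ ℓ * (A * (24 * D * ω)) :=
      le_mul_of_one_le_left (by positivity) hL'
    refine ⟨?_, by linarith⟩
    calc (A + r) * m ≤ (A + r) * (α * (ℓ * (A + r))) := by gcongr
      _ = α * (ℓ * (A + r) ^ 2) := by ring
      _ ≤ α * (ℓ * (2 * A ^ 2 + 2 * r ^ 2)) := by
        gcongr
        nlinarith [sq_nonneg (A - r)]
      _ = α * (2 * (ℓ * (A * A)) + 2 * ω ^ 2) := by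
        rw [← hrs, ← hsL]; ring
      _ ≤ α * (2 * (ℓ * (A * (24 * D * ω))) + 2 * ω ^ 2) := by gcongr
      _ ≤ _ := by
        refine mul_le_mul_of_nonneg_left ?_ hα.le
        linarith [show 0 ≤ D * (A * ℓ * ω) by positivity]
  · push Not at hA24
    have h9 : 1 + A / ℓ ≤ ω * (24 * D) := by
      rcases min_choice A (1 + A / ℓ) with h | h <;> rw [h] at hgood <;> linarith
    have h10 : ℓ + A ≤ 24 * D * (ℓ * ω) := by
      have : (ℓ : ℝ) * (1 + A / ℓ) ≤ ℓ * (ω * (24 * D)) := by gcongr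
      have h11 : (ℓ : ℝ) * (1 + A / ℓ) = ℓ + A := by field_simp
      linarith
    have hωA : ω ≤ A := by nlinarith
    constructor
    · calc (A + r) * m ≤ (A + A) * (α * (A + ω + ℓ)) := by gcongr; linarith
        _ ≤ (A + A) * (α * (2 * (24 * D * (ℓ * ω)))) := by gcongr; linarith
        _ = α * (96 * D * (A * ℓ * ω)) := by ring
        _ ≤ _ := by
          refine mul_le_mul_of_nonneg_left ?_ hα.le
          linarith [sq_nonneg ω]
    · have : A * (ℓ + A) ≤ A * (24 * D * (ℓ * ω)) := by gcongr
      nlinarith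

theorem loss_arith {D q e α : ℝ} (hd : 1 ≤ D) (hα : 0 < α) (hq0 : 0 ≤ q) (he : 0 ≤ e) :
    (D + 1) * (α * (96 * D * q + 2 * e)) + α * (24 * D * q) / 20 ≤ α * (200 * D ^ 2 * (q + e)) := by
  have h0 : D * 1 ≤ D * D := by gcongr
  have h13 : (D + 1) * (96 * D * q) + 24 * D * q / 20 ≤ 200 * D ^ 2 * q := by
    have : (D + 1) * (96 * D) + 24 * D / 20 ≤ 200 * D ^ 2 := by nlinarith
    have := mul_le_mul_of_nonneg_right this hq0
    linarith
  have h14 : (D + 1) * (2 * e) ≤ 200 * D ^ 2 * e := by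
    have : (D + 1) * 2 ≤ 200 * D ^ 2 := by nlinarith
    have := mul_le_mul_of_nonneg_right this he
    linarith
  have h15 := mul_le_mul_of_nonneg_left (add_le_add h13 h14) hα.le
  linarith

/-- The progress of one user in one round, in terms of the part `ωn` of the energy of the gradient
perturbations that does not come from the drift of the local model. -/
theorem user_progress [Nonempty (Fin d)] {ωn β c : ℝ} (hL : 1 ≤ L) (hα : 0 < α) (hω0 : 0 ≤ ω)
    (hω : ∑ k ∈ Finset.range L, ∑ i, (x k i - g i) ^ 2 ≤ ω ^ 2)
    (hA : ∀ i, |g i| ≤ A) (hi₀ : |g i₀| = A) (hv : ∀ i, v i = -(α * adaSum (fun k => x k i) L))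
    (hb : 2 ≤ b) (h1 : lam ≤ 1) (hd : (1 : ℝ) ≤ d) (hβ : 0 ≤ β) (hβα : β * α * L ≤ 1 / 32)
    (hωn : 0 ≤ ωn) (hdrift : ω ^ 2 ≤ 2 * ωn ^ 2 + c * (min A (1 + A / L) ^ 2 + ω ^ 2))
    (hc0 : 0 ≤ c) (hc : c * (1 + (24 * d) ^ 2) ≤ 1 / 2) :
    ∑ i, g i * mixedQuant b lam v i + β * supNorm v ^ 2
      ≤ α * (-(A ^ 2 / 20) + 800 * d ^ 2 * (A * L * ωn + ωn ^ 2)) := by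
  have hA0 : 0 ≤ A := hi₀ ▸ abs_nonneg _
  have hL' : (1 : ℝ) ≤ L := by exact_mod_cast hL
  have hm0 := supNorm_nonneg v
  have hm1 := supNorm_update_le_mul hα hω0 hω hA0 hA hv
  have hm2 := supNorm_update_le_add hL hα hω0 hω hA0 hA hv
  set m := supNorm v with hm
  set s := √(L : ℝ) with hs
  have hs1 : 1 ≤ s := Real.one_le_sqrt.2 hL'
  have hsL : s * s = L := Real.mul_self_sqrt (by linarith)
  set r := ω / s with hr
  have hr0 : 0 ≤ r := by positivity
  have hrs : s * r = ω := by rw [hr]; field_simp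
  have hrω : r ≤ ω := by nlinarith
  have hLr : (L : ℝ) * r = s * ω := by rw [← hsL, mul_assoc, hrs]
  have hmr : m ≤ α * (L * (A + r)) := by rw [mul_add, hLr]; exact hm1
  have hμ0 : 0 ≤ min A (1 + A / L) := le_min hA0 (by positivity)
  -- Either the update is aligned with `-g`, or `ω` is so large that noise, not drift, must be its
  -- main source.
  by_cases hgood : ω * (24 * d) ≤ min A (1 + A / L)
  · have hωA := hgood.trans (min_le_left _ _)
    have h2 := sum_mul_mixedQuant_le hL hα hω0 hω hA hi₀ hv hb h1 hd hωA
      (hgood.trans (min_le_right _ _))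
    rw [← hm] at h2
    have h3 := le_supNorm_update hL hα hω0 hω hi₀ hv
    rw [← hm] at h3
    have hω24 : ω * 24 ≤ A := by nlinarith
    have h4 : β * m ≤ A / 16 := by
      calc β * m ≤ β * (α * (L * (A + r))) := by gcongr
        _ = β * α * L * (A + r) := by ring
        _ ≤ 1 / 32 * (A + A) := by gcongr; linarith
        _ = A / 16 := by ring
    -- The second-order term consumes half of the gain `A * m / 8`; the rest is at least `23/384 α
    -- A²`, which exceeds `α A² / 20`.
    have h5 : β * m ^ 2 ≤ A / 16 * m := by rw [pow_two, ← mul_assoc]; gcongr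
    have h6 : α * (23 / 24 * A) ≤ m := le_trans (by gcongr; linarith) h3
    have h7 : A * (α * (23 / 24 * A)) ≤ A * m := by gcongr
    have h8 : 0 ≤ α * (800 * d ^ 2 * (A * L * ωn + ωn ^ 2)) := by positivity
    have h9 : 0 ≤ α * A ^ 2 := by positivity
    linarith
  · push Not at hgood
    -- Failure of alignment bounds the minimum by `24 d ω`, so the drift is at most `ω² / 2` and can
    -- be absorbed on the left.
    have h2 : ω ≤ 2 * ωn := by
      have h3 : min A (1 + A / L) ^ 2 ≤ (ω * (24 * d)) ^ 2 := pow_le_pow_left₀ hμ0 hgood.le 2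
      have h4 : c * (min A (1 + A / L) ^ 2 + ω ^ 2) ≤ c * ((ω * (24 * d)) ^ 2 + ω ^ 2) := by gcongr
      have h5 : c * ((ω * (24 * d)) ^ 2 + ω ^ 2) = c * (1 + (24 * d) ^ 2) * ω ^ 2 := by ring
      have h6 : c * (1 + (24 * d) ^ 2) * ω ^ 2 ≤ 1 / 2 * ω ^ 2 := by gcongr
      refine (le_abs_self _).trans (abs_le_of_sq_le_sq ?_ (by positivity))
      linarith
    have h3 := sum_mul_mixedQuant_le_mul hA hb h1 (v := v) (lam := lam)
    rw [← hm] at h3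
    have h4 : β * m ≤ A + r := by
      calc β * m ≤ β * (α * (L * (A + r))) := by gcongr
        _ = β * α * L * (A + r) := by ring
        _ ≤ 1 * (A + r) := by gcongr; linarith
        _ = A + r := by ring
    have h5 : β * m ^ 2 ≤ (A + r) * m := by rw [pow_two, ← mul_assoc]; gcongr
    have h6 : d * (A * m) ≤ d * ((A + r) * m) := by gcongr; linarith
    have h7 : ∑ i, g i * mixedQuant b lam v i + β * m ^ 2 ≤ (d + 1) * ((A + r) * m) := by linarith
    obtain ⟨h8, h9⟩ := update_bounds_of_large_energy hd hL' hA0 hα hω0 hr0 hm0 hsL hrs hrω hmr hm2 hgood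
    have h10 : (d + 1 : ℝ) * ((A + r) * m)
        ≤ (d + 1) * (α * (96 * d * (A * L * ω) + 2 * ω ^ 2)) := by gcongr
    have h11 : α * A ^ 2 ≤ α * (24 * d * (A * L * ω)) := by gcongr
    set q := A * L * ω with hq
    have hq0 : 0 ≤ q := by positivity
    have hq2 : q ≤ 2 * (A * L * ωn) := by
      calc q ≤ A * L * (2 * ωn) := by rw [hq]; gcongr
        _ = _ := by ring
    have hω2 : ω ^ 2 ≤ 4 * ωn ^ 2 := by
      have := pow_le_pow_left₀ hω0 h2 2
      linarith
    have h12 := loss_arith hd hα hq0 (sq_nonneg ω)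
    have h16 : α * (200 * d ^ 2 * (q + ω ^ 2)) ≤ α * (800 * d ^ 2 * (A * L * ωn + ωn ^ 2)) := by
      calc α * (200 * d ^ 2 * (q + ω ^ 2))
          ≤ α * (200 * d ^ 2 * (4 * (A * L * ωn) + 4 * ωn ^ 2)) := by
            gcongr
            linarith [show 0 ≤ A * L * ωn by positivity]
        _ = _ := by ring
    linarith

end UserStep

namespace Problem

/-! ### Gradients of the local and global losses -/

variable {d K : ℕ} {X : Type u} {Y : Type v} {P : Problem d K X Y}

theorem hasGradientAt_sum_mul {ι : Type*} (s : Finset ι) (c : ι → ℝ) (f : ι → Vec d → ℝ)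
    (w : Vec d) (hf : ∀ i, DifferentiableAt ℝ (f i) w) :
    HasGradientAt (fun w => ∑ i ∈ s, c i * f i w) (∑ i ∈ s, c i • gradient (f i) w) w := by
  rw [hasGradientAt_iff_hasFDerivAt, map_sum]
  refine HasFDerivAt.fun_sum fun i _ => ?_
  rw [map_smul]
  exact ((hf i).hasGradientAt.hasFDerivAt).const_mul (c i)

theorem hasGradientAt_localLoss (hdiff : P.DifferentiableLoss) (j : Fin K) (w : Vec d) :
    HasGradientAt (P.localLoss j) (∑ n, (P.size j : ℝ)⁻¹ • P.sampleGrad j n w) w := by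
  have := hasGradientAt_sum_mul Finset.univ (fun _ => (P.size j : ℝ)⁻¹)
    (fun n w => P.loss w (P.sample j n)) w fun n => hdiff j n w
  refine this.congr_of_eventuallyEq (Filter.Eventually.of_forall fun w => ?_)
  simp [localLoss, ← Finset.mul_sum, div_eq_inv_mul]

theorem gradient_localLoss (hdiff : P.DifferentiableLoss) (j : Fin K) (w : Vec d) :
    gradient (P.localLoss j) w = ∑ n, (P.size j : ℝ)⁻¹ • P.sampleGrad j n w :=
  (hasGradientAt_localLoss hdiff j w).gradient

theorem differentiable_localLoss (hdiff : P.DifferentiableLoss) (j : Fin K) :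
    Differentiable ℝ (P.localLoss j) := fun w => (hasGradientAt_localLoss hdiff j w).differentiableAt

theorem hasGradientAt_globalLoss (hdiff : P.DifferentiableLoss) (w : Vec d) :
    HasGradientAt P.globalLoss (∑ j, P.weight j • gradient (P.localLoss j) w) w :=
  hasGradientAt_sum_mul Finset.univ P.weight P.localLoss w
    fun j => differentiable_localLoss hdiff j w

theorem gradient_globalLoss (hdiff : P.DifferentiableLoss) (w : Vec d) :
    gradient P.globalLoss w = ∑ j, P.weight j • gradient (P.localLoss j) w :=
  (hasGradientAt_globalLoss hdiff w).gradient

theorem weight_nonneg (j : Fin K) : 0 ≤ P.weight j := by unfold weight; positivity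

theorem sum_weight (hK : 1 ≤ K) (hsize : ∀ j, 1 ≤ P.size j) : ∑ j, P.weight j = 1 := by
  have : Nonempty (Fin K) := ⟨⟨0, hK⟩⟩
  unfold weight
  rw [← Finset.sum_div, div_self]
  refine (Finset.sum_pos (fun j _ => ?_) Finset.univ_nonempty).ne'
  exact_mod_cast hsize j

theorem abs_gradient_localLoss_le (hdiff : P.DifferentiableLoss) {G : ℝ} (hG : P.GradBounded G)
    (hsize : ∀ j, 1 ≤ P.size j) (j : Fin K) (w : Vec d) (i : Fin d) :
    |gradient (P.localLoss j) w i| ≤ G := by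
  have hs : (0 : ℝ) < P.size j := by exact_mod_cast hsize j
  rw [gradient_localLoss hdiff]
  simp only [WithLp.ofLp_sum, WithLp.ofLp_smul, Finset.sum_apply, Pi.smul_apply, smul_eq_mul]
  refine (Finset.abs_sum_le_sum_abs _ _).trans ?_
  have : ∀ n ∈ Finset.univ, |(P.size j : ℝ)⁻¹ * P.sampleGrad j n w i| ≤ (P.size j : ℝ)⁻¹ * G := by
    intro n _
    rw [abs_mul, abs_of_pos (inv_pos.2 hs)]
    gcongr
    exact hG j n w i
  refine (Finset.sum_le_sum this).trans (le_of_eq ?_)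
  simp only [Finset.sum_const, Finset.card_univ, Fintype.card_fin, nsmul_eq_mul]
  field_simp

theorem abs_gradient_globalLoss_le (hdiff : P.DifferentiableLoss) {G : ℝ} (hG : P.GradBounded G)
    (hK : 1 ≤ K) (hsize : ∀ j, 1 ≤ P.size j) (w : Vec d) (i : Fin d) :
    |gradient P.globalLoss w i| ≤ G := by
  rw [gradient_globalLoss hdiff]
  simp only [WithLp.ofLp_sum, WithLp.ofLp_smul, Finset.sum_apply, Pi.smul_apply, smul_eq_mul]
  refine (Finset.abs_sum_le_sum_abs _ _).trans ?_
  have : ∀ j ∈ Finset.univ, |P.weight j * gradient (P.localLoss j) w i| ≤ P.weight j * G := by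
    intro j _
    rw [abs_mul, abs_of_nonneg (weight_nonneg j)]
    exact mul_le_mul_of_nonneg_left (abs_gradient_localLoss_le hdiff hG hsize j w i)
      (weight_nonneg j)
  refine (Finset.sum_le_sum this).trans (le_of_eq ?_)
  rw [← Finset.sum_mul, sum_weight hK hsize, one_mul]

theorem norm_gradient_globalLoss_sub_le (hdiff : P.DifferentiableLoss) {Lbar : ℝ}
    (hsm : P.Smooth Lbar) (hK : 1 ≤ K) (hsize : ∀ j, 1 ≤ P.size j) (w w' : Vec d) :
    ‖gradient P.globalLoss w - gradient P.globalLoss w'‖ ≤ Lbar * ‖w - w'‖ := by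
  rw [gradient_globalLoss hdiff, gradient_globalLoss hdiff, ← Finset.sum_sub_distrib]
  refine (norm_sum_le _ _).trans ?_
  have : ∀ j ∈ Finset.univ, ‖P.weight j • gradient (P.localLoss j) w
      - P.weight j • gradient (P.localLoss j) w'‖ ≤ P.weight j * (Lbar * ‖w - w'‖) := by
    intro j _
    rw [← smul_sub, norm_smul, Real.norm_of_nonneg (weight_nonneg j)]
    exact mul_le_mul_of_nonneg_left (hsm j w w') (weight_nonneg j)
  refine (Finset.sum_le_sum this).trans (le_of_eq ?_)
  rw [← Finset.sum_mul, sum_weight hK hsize, one_mul]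

/-- The mean value inequality on the segment gives the quadratic term with constant `Lbar`; the
sharper `Lbar / 2` is not needed. -/
theorem globalLoss_add_le (hdiff : P.DifferentiableLoss) {Lbar : ℝ} (hLbar : 0 ≤ Lbar)
    (hsm : P.Smooth Lbar) (hK : 1 ≤ K) (hsize : ∀ j, 1 ≤ P.size j) (w δ : Vec d) :
    P.globalLoss (w + δ)
      ≤ P.globalLoss w + inner ℝ (gradient P.globalLoss w) δ + Lbar * ‖δ‖ ^ 2 := by
  have hdg : ∀ z, HasGradientAt P.globalLoss (gradient P.globalLoss z) z := fun z =>
    (hasGradientAt_globalLoss hdiff z).differentiableAt.hasGradientAt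
  have h := Convex.norm_image_sub_le_of_norm_hasFDerivWithin_le' (𝕜 := ℝ) (f := P.globalLoss)
    (s := segment ℝ w (w + δ)) (x := w) (y := w + δ)
    (f' := fun z => InnerProductSpace.toDual ℝ (Vec d) (gradient P.globalLoss z))
    (φ := InnerProductSpace.toDual ℝ (Vec d) (gradient P.globalLoss w)) (C := Lbar * ‖δ‖)
    (fun z _ => (hdg z).hasFDerivAt.hasFDerivWithinAt) (fun z hz => ?_) (convex_segment _ _)
    (left_mem_segment _ _ _) (right_mem_segment _ _ _)
  · rw [add_sub_cancel_left, InnerProductSpace.toDual_apply_apply, Real.norm_eq_abs] at h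
    have := (abs_le.1 h).2
    nlinarith
  · rw [← map_sub, LinearIsometryEquiv.norm_map]
    refine (norm_gradient_globalLoss_sub_le hdiff hsm hK hsize z w).trans ?_
    gcongr
    obtain ⟨θ, hθ, rfl⟩ := (segment_eq_image' ℝ w (w + δ)).subset hz
    simp only [add_sub_cancel_left]
    rw [norm_smul, Real.norm_of_nonneg hθ.1]
    exact mul_le_of_le_one_left (norm_nonneg _) hθ.2

end Problem

namespace Params

/-! ### One round of the algorithm -/

variable {d K : ℕ} {X : Type u} {Y : Type v} {A : Params d K} {P : Problem d K X Y}

/-- The local model of user `j` after `h` local steps of round `t + 1`. -/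
noncomputable def localModel (ω : A.Batches P) (t : ℕ) (j : Fin K) (w : Vec d) (h : ℕ) : Vec d :=
  (localState ω t j w h).1

/-- The stochastic gradients that user `j` uses in round `t + 1`, divided by `√εa`. -/
noncomputable def scaledGrad (ω : A.Batches P) (t : ℕ) (j : Fin K) (w : Vec d) (h : ℕ)
    (i : Fin d) : ℝ :=
  stochGrad ω t j h (localModel ω t j w h) i / √A.εa

/-- Factoring `εa` out of the accumulator turns the constant under the root into 1. The shift by one
is due to the accumulator being updated before the step that uses it. -/
theorem localState_succ_snd (hε : 0 < A.εa) (ω : A.Batches P) (t : ℕ) (j : Fin K) (w : Vec d)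
    (h : ℕ) (i : Fin d) :
    (localState ω t j w (h + 1)).2 i
      = A.εa * adaAcc (fun k => scaledGrad ω t j w k i) h := by
  induction h with
  | zero => simp [localState, adaAcc_zero]
  | succ h ih =>
    rw [adaAcc_succ, mul_add, ← ih, localState]
    simp only [Nat.add_eq_zero_iff, one_ne_zero, and_false, if_false, scaledGrad, localModel]
    rw [div_pow, Real.sq_sqrt hε.le]
    field_simp

theorem localModel_apply (hε : 0 < A.εa) (ω : A.Batches P) (t : ℕ) (j : Fin K) (w : Vec d)
    (h : ℕ) (i : Fin d) :
    localModel ω t j w h i = w i - A.α * adaSum (fun k => scaledGrad ω t j w k i) h := by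
  induction h with
  | zero => simp [localModel, localState, adaSum]
  | succ h ih =>
    have h1 := localState_succ_snd hε ω t j w h i
    have h2 : localModel ω t j w (h + 1) i = localModel ω t j w h i
        - A.α / √((localState ω t j w (h + 1)).2 i + A.εa)
          * stochGrad ω t j h (localModel ω t j w h) i := rfl
    rw [h2, h1, ih, adaSum, adaSum, Finset.sum_range_succ, mul_add, ← sub_sub]
    congr 1
    have h3 : A.εa * adaAcc (fun k => scaledGrad ω t j w k i) h + A.εa
        = A.εa * (adaAcc (fun k => scaledGrad ω t j w k i) h + 1) := by ring
    have h4 : √A.εa ≠ 0 := (Real.sqrt_pos.2 hε).ne'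
    have h5 := one_le_sqrt_adaAcc (fun k => scaledGrad ω t j w k i) h
    have h6 : √(adaAcc (fun k => scaledGrad ω t j w k i) h + 1) ≠ 0 := by linarith
    rw [h3, Real.sqrt_mul hε.le]
    simp only [scaledGrad] at h6 ⊢
    field_simp

theorem localUpdate_apply (hε : 0 < A.εa) (ω : A.Batches P) (t : ℕ) (j : Fin K) (w : Vec d)
    (i : Fin d) :
    localUpdate ω t j w i = -(A.α * adaSum (fun k => scaledGrad ω t j w k i) A.L) := by
  have := localModel_apply hε ω t j w A.L i
  simp only [localUpdate, PiLp.sub_apply]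
  simp only [localModel] at this
  rw [this]
  ring

/-- The sampling error of user `j` in local step `h + 1` of round `t + 1`. -/
noncomputable def samplingError (ω : A.Batches P) (t : ℕ) (j : Fin K) (w : Vec d) (h : ℕ) : Vec d :=
  ∑ n ∈ miniBatch ω t j h, (P.sampleGrad j n (localModel ω t j w h)
    - gradient (P.localLoss j) (localModel ω t j w h))

/-- The energy of the gradient perturbations of user `j` in round `t + 1` that come from the
sampling and from the difference of the local and global losses. -/
noncomputable def userNoise (ω : A.Batches P) (t : ℕ) (j : Fin K) (w : Vec d) : ℝ :=
  ∑ h ∈ Finset.range A.L, ‖samplingError ω t j w h‖ ^ 2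
    + A.L * ‖gradient (P.localLoss j) w - gradient P.globalLoss w‖ ^ 2

theorem userNoise_nonneg (ω : A.Batches P) (t : ℕ) (j : Fin K) (w : Vec d) :
    0 ≤ userNoise ω t j w := by unfold userNoise; positivity

/-! ### Energy of the gradient perturbations: noise and drift -/

theorem card_miniBatch (ω : A.Batches P) {t h : ℕ} (ht : t < A.T) (hh : h < A.L) (j : Fin K) :
    (miniBatch ω t j h).card = A.batch j := by
  rw [miniBatch, dif_pos ⟨ht, hh⟩]
  exact (ω _).2

theorem norm_sub_sq_stochGrad_le {Lbar B : ℝ} (hsm : P.Smooth Lbar) (ω : A.Batches P) {t h : ℕ}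
    (ht : t < A.T) (hh : h < A.L) {j : Fin K} (hB : (A.batch j : ℝ) ≤ B) (hB1 : 1 ≤ B)
    (w : Vec d) :
    ‖stochGrad ω t j h (localModel ω t j w h) - (A.batch j : ℝ) • gradient P.globalLoss w‖ ^ 2
      ≤ 4 * B ^ 2 * (‖samplingError ω t j w h‖ ^ 2
          + ‖gradient (P.localLoss j) w - gradient P.globalLoss w‖ ^ 2)
        + 2 * B ^ 2 * Lbar ^ 2 * ‖localModel ω t j w h - w‖ ^ 2 := by
  set z := localModel ω t j w h with hz
  set ξ : ℝ := (A.batch j : ℝ) with hξ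
  have hξ0 : 0 ≤ ξ := Nat.cast_nonneg _
  have hsplit : stochGrad ω t j h z - ξ • gradient P.globalLoss w
      = (samplingError ω t j w h + ξ • (gradient (P.localLoss j) w - gradient P.globalLoss w))
        + ξ • (gradient (P.localLoss j) z - gradient (P.localLoss j) w) := by
    rw [samplingError, Finset.sum_sub_distrib, Finset.sum_const, card_miniBatch ω ht hh, ← hz,
      ← Nat.cast_smul_eq_nsmul ℝ, ← hξ, stochGrad]
    module
  have hsq : ∀ a b : Vec d, ‖a + b‖ ^ 2 ≤ 2 * ‖a‖ ^ 2 + 2 * ‖b‖ ^ 2 := fun a b => by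
    have := pow_le_pow_left₀ (norm_nonneg _) (norm_add_le a b) 2
    nlinarith [sq_nonneg (‖a‖ - ‖b‖)]
  rw [hsplit]
  have h1 := hsq (samplingError ω t j w h
    + ξ • (gradient (P.localLoss j) w - gradient P.globalLoss w))
    (ξ • (gradient (P.localLoss j) z - gradient (P.localLoss j) w))
  have h2 := hsq (samplingError ω t j w h)
    (ξ • (gradient (P.localLoss j) w - gradient P.globalLoss w))
  rw [norm_smul, Real.norm_of_nonneg hξ0, mul_pow] at h1 h2
  have h3 := pow_le_pow_left₀ (norm_nonneg _) (hsm j z w) 2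
  have h4 : ξ ^ 2 ≤ B ^ 2 := pow_le_pow_left₀ hξ0 hB 2
  have h5 : ξ ^ 2 * ‖gradient (P.localLoss j) z - gradient (P.localLoss j) w‖ ^ 2
      ≤ B ^ 2 * (Lbar * ‖z - w‖) ^ 2 := by gcongr
  have h6 : ξ ^ 2 * ‖gradient (P.localLoss j) w - gradient P.globalLoss w‖ ^ 2
      ≤ B ^ 2 * ‖gradient (P.localLoss j) w - gradient P.globalLoss w‖ ^ 2 := by gcongr
  have h7 : 1 * ‖samplingError ω t j w h‖ ^ 2 ≤ B ^ 2 * ‖samplingError ω t j w h‖ ^ 2 := by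
    gcongr
    nlinarith
  nlinarith

/-- The energy of all gradient perturbations of user `j` in round `t + 1`, after scaling. -/
noncomputable def energy (ω : A.Batches P) (t : ℕ) (j : Fin K) (w : Vec d) : ℝ :=
  √(∑ k ∈ Finset.range A.L, ∑ i, (scaledGrad ω t j w k i
    - A.batch j * gradient P.globalLoss w i / √A.εa) ^ 2)

theorem energy_spec (ω : A.Batches P) (t : ℕ) (j : Fin K) (w : Vec d) :
    ∑ k ∈ Finset.range A.L, ∑ i, (scaledGrad ω t j w k i
      - A.batch j * gradient P.globalLoss w i / √A.εa) ^ 2 ≤ energy ω t j w ^ 2 := by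
  rw [energy, Real.sq_sqrt]
  positivity

/-- Both bounds on `adaSum` hold for partial sums; taking the better one produces `min M (1 + M /
L)`, the same quantity that decides alignment. A drift bound in terms of `M` alone could not be
absorbed when alignment fails. -/
theorem norm_localModel_sub_sq_le (hA : A.Admissible P) (ω : A.Batches P) (t : ℕ) (j : Fin K)
    (w : Vec d) {M : ℝ} (hM : ∀ i, |A.batch j * gradient P.globalLoss w i / √A.εa| ≤ M)
    (hM0 : 0 ≤ M) {h : ℕ} (hh : h ≤ A.L) :
    ‖localModel ω t j w h - w‖ ^ 2
      ≤ d * (2 * A.α ^ 2 * A.L ^ 2 * (min M (1 + M / A.L) ^ 2 + energy ω t j w ^ 2)) := by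
  have hα := hA.α_pos
  have hL' : (1 : ℝ) ≤ A.L := by exact_mod_cast hA.one_le_L
  have he0 : 0 ≤ energy ω t j w := Real.sqrt_nonneg _
  set μ := min M (1 + M / A.L)
  have hμ : 0 ≤ μ := le_min hM0 (by positivity)
  rw [EuclideanSpace.norm_sq_eq]
  have : ∀ i ∈ Finset.univ, ‖(localModel ω t j w h - w) i‖ ^ 2
      ≤ 2 * A.α ^ 2 * A.L ^ 2 * (μ ^ 2 + energy ω t j w ^ 2) := by
    intro i _
    have h1 := abs_adaSum_le_mul he0 (energy_apply (energy_spec ω t j w) i) (hM i) hh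
    have h2 := abs_adaSum_le_add hA.one_le_L he0 (energy_apply (energy_spec ω t j w) i) (hM i) hh
    have h3 : |adaSum (fun k => scaledGrad ω t j w k i) h| ≤ A.L * (μ + energy ω t j w) := by
      have hs : √(A.L : ℝ) ≤ A.L := Real.sqrt_le_iff.2 ⟨by linarith, by nlinarith⟩
      have h4 : √(A.L : ℝ) * energy ω t j w ≤ A.L * energy ω t j w := by gcongr
      have h5 : 1 * energy ω t j w ≤ A.L * energy ω t j w := by gcongr
      have h6 : (A.L : ℝ) * (1 + M / A.L) = A.L + M := by field_simp
      rcases min_choice M (1 + M / A.L) with h | h <;> simp only [μ, h] <;> linarith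
    have h4 : |(localModel ω t j w h - w) i| ≤ A.α * (A.L * (μ + energy ω t j w)) := by
      rw [PiLp.sub_apply, localModel_apply hA.εa_pos, sub_sub_cancel_left, abs_neg, abs_mul,
        abs_of_pos hα]
      gcongr
    rw [Real.norm_eq_abs]
    refine (pow_le_pow_left₀ (abs_nonneg _) h4 2).trans ?_
    have h5 : (μ + energy ω t j w) ^ 2 ≤ 2 * (μ ^ 2 + energy ω t j w ^ 2) := by
      nlinarith [sq_nonneg (μ - energy ω t j w)]
    calc (A.α * (A.L * (μ + energy ω t j w))) ^ 2
        = A.α ^ 2 * A.L ^ 2 * (μ + energy ω t j w) ^ 2 := by ring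
      _ ≤ A.α ^ 2 * A.L ^ 2 * (2 * (μ ^ 2 + energy ω t j w ^ 2)) := by gcongr
      _ = _ := by ring
  refine (Finset.sum_le_sum this).trans (le_of_eq ?_)
  simp

/-- A self-bounding estimate: drift makes the gradients deviate, and the deviation enters the drift.
The factor `α² L³` combines the squared drift `α² L²` with the sum over `L` steps. -/
theorem energy_sq_le (hA : A.Admissible P) {Lbar B : ℝ} (hsm : P.Smooth Lbar) (ω : A.Batches P)
    {t : ℕ} (ht : t < A.T) {j : Fin K} (hB : (A.batch j : ℝ) ≤ B) (hB1 : 1 ≤ B) (w : Vec d)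
    {M : ℝ} (hM : ∀ i, |A.batch j * gradient P.globalLoss w i / √A.εa| ≤ M) (hM0 : 0 ≤ M) :
    energy ω t j w ^ 2 ≤ 2 * √(2 * B ^ 2 / A.εa * userNoise ω t j w) ^ 2
      + 4 * d * B ^ 2 * Lbar ^ 2 * (A.α ^ 2 * A.L ^ 3) / A.εa
        * (min M (1 + M / A.L) ^ 2 + energy ω t j w ^ 2) := by
  have hε := hA.εa_pos
  have hW := userNoise_nonneg ω t j w
  rw [Real.sq_sqrt (by positivity)]
  set μe := min M (1 + M / A.L) ^ 2 + energy ω t j w ^ 2 with hμe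
  have h1 : energy ω t j w ^ 2 = ∑ k ∈ Finset.range A.L,
      ‖stochGrad ω t j k (localModel ω t j w k)
        - (A.batch j : ℝ) • gradient P.globalLoss w‖ ^ 2 / A.εa := by
    rw [energy, Real.sq_sqrt (by positivity)]
    refine Finset.sum_congr rfl fun k _ => ?_
    rw [EuclideanSpace.norm_sq_eq, Finset.sum_div]
    refine Finset.sum_congr rfl fun i _ => ?_
    rw [scaledGrad, ← sub_div, div_pow, Real.sq_sqrt hε.le, Real.norm_eq_abs, sq_abs]
    simp
  have h2 : ∀ k ∈ Finset.range A.L, ‖stochGrad ω t j k (localModel ω t j w k)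
        - (A.batch j : ℝ) • gradient P.globalLoss w‖ ^ 2 / A.εa
      ≤ 4 * B ^ 2 / A.εa * ‖samplingError ω t j w k‖ ^ 2
        + (4 * B ^ 2 / A.εa * ‖gradient (P.localLoss j) w - gradient P.globalLoss w‖ ^ 2
        + 2 * B ^ 2 * Lbar ^ 2 / A.εa * (d * (2 * A.α ^ 2 * A.L ^ 2 * μe))) := by
    intro k hk
    have hk' := Finset.mem_range.1 hk
    have h3 := norm_sub_sq_stochGrad_le hsm ω ht hk' hB hB1 w
    have h4 := norm_localModel_sub_sq_le hA ω t j w hM hM0 hk'.le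
    rw [← hμe] at h4
    have h5 : 2 * B ^ 2 * Lbar ^ 2 * ‖localModel ω t j w k - w‖ ^ 2
        ≤ 2 * B ^ 2 * Lbar ^ 2 * (d * (2 * A.α ^ 2 * A.L ^ 2 * μe)) := by gcongr
    calc _ ≤ (4 * B ^ 2 * (‖samplingError ω t j w k‖ ^ 2
          + ‖gradient (P.localLoss j) w - gradient P.globalLoss w‖ ^ 2)
        + 2 * B ^ 2 * Lbar ^ 2 * (d * (2 * A.α ^ 2 * A.L ^ 2 * μe))) / A.εa := by
          gcongr
          linarith
      _ = _ := by ring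
  have h3 := Finset.sum_le_sum h2
  rw [← h1, Finset.sum_add_distrib, ← Finset.mul_sum] at h3
  simp only [Finset.sum_const, Finset.card_range, nsmul_eq_mul] at h3
  refine h3.trans (le_of_eq ?_)
  rw [userNoise]
  ring

/-! ### Effect of one round on the loss and on the gradient -/

theorem norm_sq_le_card_mul {v : Vec d} {a : ℝ} (h : ∀ i, |v i| ≤ a) : ‖v‖ ^ 2 ≤ d * a ^ 2 := by
  rw [EuclideanSpace.norm_sq_eq]
  have : ∀ i ∈ Finset.univ, ‖v i‖ ^ 2 ≤ a ^ 2 := fun i _ =>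
    pow_le_pow_left₀ (norm_nonneg _) (h i) 2
  refine (Finset.sum_le_sum this).trans (le_of_eq ?_)
  simp

/-- `user_progress` in the original scale: the comparison vector is `ξ / √εa` times the gradient, so
the inequality is multiplied by `√εa / ξ`, and the smoothness term is encoded in `β = Lbar d ξ /
√εa`. -/
theorem inner_mixedQuant_le (hA : A.Admissible P) (hdiff : P.DifferentiableLoss)
    {Lbar B G : ℝ} (hLbar : 0 < Lbar) (hsm : P.Smooth Lbar) (hG : P.GradBounded G) (hG0 : 0 < G)
    (hK : 1 ≤ K) (hd : 1 ≤ d) (hB1 : 1 ≤ B)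
    (h1 : Lbar * d * B / √A.εa * (A.α * A.L) ≤ 1 / 32)
    (h2 : 4 * d * B ^ 2 * Lbar ^ 2 * (A.α ^ 2 * A.L ^ 3) / A.εa * (1 + (24 * d) ^ 2) ≤ 1 / 2)
    (ω : A.Batches P) {t : ℕ} (ht : t < A.T) (j : Fin K) (hB : (A.batch j : ℝ) ≤ B) (w : Vec d) :
    inner ℝ (gradient P.globalLoss w) (mixedQuant (A.bits j) (A.lam j) (localUpdate ω t j w))
        + Lbar * (d * supNorm (localUpdate ω t j w) ^ 2)
      ≤ A.α * (-(‖gradient P.globalLoss w‖ ^ 2 / (20 * d * √A.εa))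
        + 800 * d ^ 2 * (B ^ 2 / A.εa + 1 / 2 + 2 * B ^ 2 / √A.εa)
          * ((G * √A.T + 1) * userNoise ω t j w + G * A.L ^ 2 / √A.T)) := by
  have hε := hA.εa_pos
  have hα := hA.α_pos
  have hL' : (1 : ℝ) ≤ A.L := by exact_mod_cast hA.one_le_L
  have hT' : (1 : ℝ) ≤ A.T := by exact_mod_cast hA.one_le_T
  have hd' : (1 : ℝ) ≤ d := by exact_mod_cast hd
  have : Nonempty (Fin d) := ⟨⟨0, hd⟩⟩
  have hsize : ∀ j, 1 ≤ P.size j := fun j => (hA.one_le_batch j).trans (hA.batch_le j)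
  have hξ1 : (1 : ℝ) ≤ A.batch j := by exact_mod_cast hA.one_le_batch j
  set γ := gradient P.globalLoss w with hγ
  set ξ : ℝ := (A.batch j : ℝ) with hξ
  set e := √A.εa with he
  have he0 : 0 < e := Real.sqrt_pos.2 hε
  have hee : e * e = A.εa := Real.mul_self_sqrt hε.le
  obtain ⟨i₀, hi₀⟩ := exists_abs_eq_supNorm γ
  set a := supNorm γ with ha
  have ha0 : 0 ≤ a := supNorm_nonneg _
  have haG : a ≤ G := supNorm_le hG0.le
    (Problem.abs_gradient_globalLoss_le hdiff hG hK hsize w)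
  set W := userNoise ω t j w with hW
  have hW0 : 0 ≤ W := userNoise_nonneg ω t j w
  set M := ξ * a / e with hM
  have hM0 : 0 ≤ M := by positivity
  have habs : ∀ i, |ξ * γ i / e| = ξ * |γ i| / e := fun i => by
    rw [abs_div, abs_mul, abs_of_pos he0, abs_of_nonneg (by linarith : (0 : ℝ) ≤ ξ)]
  have hgM : ∀ i, |ξ * γ i / e| ≤ M := fun i => by
    rw [habs, hM]
    gcongr
    exact abs_le_supNorm γ i
  set ωn := √(2 * B ^ 2 / A.εa * W) with hωn
  have hωn0 : 0 ≤ ωn := Real.sqrt_nonneg _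
  have hωn2 : ωn ^ 2 = 2 * B ^ 2 / A.εa * W := Real.sq_sqrt (by positivity)
  have hβ : Lbar * d * ξ / e * A.α * A.L ≤ 1 / 32 := by
    refine le_trans ?_ h1
    rw [mul_assoc]
    gcongr
  have key := user_progress (x := scaledGrad ω t j w) (g := fun i => ξ * γ i / e) (A := M)
    (ω := energy ω t j w) (α := A.α) (v := localUpdate ω t j w) (i₀ := i₀) (b := A.bits j)
    (lam := A.lam j) (ωn := ωn) (β := Lbar * d * ξ / e) hA.one_le_L hα (Real.sqrt_nonneg _)
    (energy_spec ω t j w) hgM (by rw [habs, hi₀]) (localUpdate_apply hε ω t j w)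
    (hA.two_le_bits j) (hA.lam_le_one j) hd' (by positivity) hβ hωn0
    (energy_sq_le hA hsm ω ht hB hB1 w hgM hM0) (by positivity) h2
  set m := supNorm (localUpdate ω t j w) with hm
  set Q := mixedQuant (A.bits j) (A.lam j) (localUpdate ω t j w) with hQ
  have hin : inner ℝ γ Q = e / ξ * ∑ i, ξ * γ i / e * Q i := by
    rw [PiLp.inner_apply, Finset.mul_sum]
    refine Finset.sum_congr rfl fun i _ => ?_
    simp only [RCLike.inner_apply, conj_trivial]
    field_simp
  have hm2 : Lbar * (d * m ^ 2) = e / ξ * (Lbar * d * ξ / e * m ^ 2) := by field_simp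
  rw [hin, hm2, ← mul_add]
  refine (mul_le_mul_of_nonneg_left key (by positivity)).trans ?_
  rw [mul_left_comm]
  refine mul_le_mul_of_nonneg_left ?_ hα.le
  have hmain : e / ξ * (M ^ 2 / 20) ≥ ‖γ‖ ^ 2 / (20 * d * e) := by
    have h3 : ‖γ‖ ^ 2 ≤ d * a ^ 2 := norm_sq_le_card_mul (abs_le_supNorm γ)
    have h4 : e / ξ * (M ^ 2 / 20) = ξ * (a ^ 2 / (20 * e)) := by rw [hM]; field_simp
    rw [h4]
    calc ‖γ‖ ^ 2 / (20 * d * e) ≤ d * a ^ 2 / (20 * d * e) := by gcongr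
      _ = 1 * (a ^ 2 / (20 * e)) := by field_simp
      _ ≤ ξ * (a ^ 2 / (20 * e)) := by gcongr
  have hloss1 : e / ξ * (M * A.L * ωn) ≤ (B ^ 2 / A.εa + 1 / 2) * (G * √A.T * W + G * A.L ^ 2 / √A.T) := by
    have h3 : e / ξ * (M * A.L * ωn) = a * A.L * ωn := by rw [hM]; field_simp
    have hsT : 0 < √(A.T : ℝ) := Real.sqrt_pos.2 (by linarith)
    -- Young's inequality with weight `√T`, which yields the rate `G / √T`.
    have h4 : A.L * ωn ≤ 1 / 2 * (√A.T * ωn ^ 2 + A.L ^ 2 / √A.T) := by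
      have h5 : √A.T * (ωn - A.L / √A.T) ^ 2
          = √A.T * ωn ^ 2 + A.L ^ 2 / √A.T - 2 * (A.L * ωn) := by field_simp; ring
      have h6 : 0 ≤ √A.T * (ωn - A.L / √A.T) ^ 2 := by positivity
      linarith
    rw [h3, mul_assoc]
    calc a * (A.L * ωn) ≤ G * (1 / 2 * (√A.T * ωn ^ 2 + A.L ^ 2 / √A.T)) := by gcongr
      _ = B ^ 2 / A.εa * (G * √A.T * W) + 1 / 2 * (G * A.L ^ 2 / √A.T) := by rw [hωn2]; ring
      _ ≤ (B ^ 2 / A.εa + 1 / 2) * (G * √A.T * W) + (B ^ 2 / A.εa + 1 / 2) * (G * A.L ^ 2 / √A.T) := by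
        gcongr
        · linarith
        · have : 0 ≤ B ^ 2 / A.εa := by positivity
          linarith
      _ = _ := by ring
  have hloss2 : e / ξ * ωn ^ 2 ≤ 2 * B ^ 2 / e * W := by
    calc e / ξ * ωn ^ 2 ≤ e / 1 * ωn ^ 2 := by gcongr
      _ = 2 * B ^ 2 / e * W := by rw [hωn2, ← hee]; field_simp
  have hS : e / ξ * (M * A.L * ωn) + e / ξ * ωn ^ 2
      ≤ (B ^ 2 / A.εa + 1 / 2 + 2 * B ^ 2 / e) * ((G * √A.T + 1) * W + G * A.L ^ 2 / √A.T) := by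
    have h3 : 0 ≤ (B ^ 2 / A.εa + 1 / 2) * W := by positivity
    have h4 : 0 ≤ 2 * B ^ 2 / e * (G * √A.T * W + G * A.L ^ 2 / √A.T) := by positivity
    linarith
  have hS2 := mul_le_mul_of_nonneg_left hS (by positivity : (0 : ℝ) ≤ 800 * d ^ 2)
  calc e / ξ * (-(M ^ 2 / 20) + 800 * d ^ 2 * (M * A.L * ωn + ωn ^ 2))
      = -(e / ξ * (M ^ 2 / 20))
        + 800 * d ^ 2 * (e / ξ * (M * A.L * ωn) + e / ξ * ωn ^ 2) := by ring
    _ ≤ _ := by linarith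

/-- With the drift coefficient at most `1/2`, the energy is bounded by gradient and noise, and `α L
≤ 1 / (16 Lbar)` removes the step size. This serves to compare the gradients at consecutive global
models. -/
theorem supNorm_localUpdate_sq_le (hA : A.Admissible P)
    {Lbar B : ℝ} (hLbar : 0 < Lbar) (hsm : P.Smooth Lbar) (hB1 : 1 ≤ B)
    (hαL : A.α * A.L * Lbar ≤ 1 / 16)
    (h2 : 4 * d * B ^ 2 * Lbar ^ 2 * (A.α ^ 2 * A.L ^ 3) / A.εa * (1 + (24 * d) ^ 2) ≤ 1 / 2)
    (ω : A.Batches P) {t : ℕ} (ht : t < A.T) (j : Fin K) (hB : (A.batch j : ℝ) ≤ B) (w : Vec d) :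
    supNorm (localUpdate ω t j w) ^ 2
      ≤ B ^ 2 / (A.εa * Lbar ^ 2) * (‖gradient P.globalLoss w‖ ^ 2 + userNoise ω t j w) := by
  have hε := hA.εa_pos
  have hα := hA.α_pos
  have hL' : (1 : ℝ) ≤ A.L := by exact_mod_cast hA.one_le_L
  set γ := gradient P.globalLoss w with hγ
  set ξ : ℝ := (A.batch j : ℝ) with hξ
  have hξ0 : 0 ≤ ξ := Nat.cast_nonneg _
  set e := √A.εa with he
  have he0 : 0 < e := Real.sqrt_pos.2 hε
  have hee : e ^ 2 = A.εa := Real.sq_sqrt hε.le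
  set W := userNoise ω t j w with hW
  have hW0 : 0 ≤ W := userNoise_nonneg ω t j w
  set M := B * ‖γ‖ / e with hM
  have hM0 : 0 ≤ M := by positivity
  have hgM : ∀ i, |ξ * γ i / e| ≤ M := fun i => by
    rw [abs_div, abs_mul, abs_of_pos he0, abs_of_nonneg hξ0, hM]
    gcongr
    exact PiLp.norm_apply_le γ i
  have hen := energy_sq_le hA hsm ω ht hB hB1 w hgM hM0
  rw [Real.sq_sqrt (by positivity)] at hen
  set c := 4 * d * B ^ 2 * Lbar ^ 2 * (A.α ^ 2 * A.L ^ 3) / A.εa with hc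
  have hc0 : 0 ≤ c := by positivity
  have hc1 : c ≤ 1 / 2 := by nlinarith [sq_nonneg (24 * (d : ℝ))]
  have hμ : min M (1 + M / A.L) ^ 2 ≤ M ^ 2 :=
    pow_le_pow_left₀ (le_min hM0 (by positivity)) (min_le_left _ _) 2
  set η := energy ω t j w with hη
  have hη0 : 0 ≤ η := Real.sqrt_nonneg _
  have hen2 : η ^ 2 ≤ 8 * (B ^ 2 / A.εa * W) + M ^ 2 := by
    have hW2 : 2 * B ^ 2 / A.εa * W = 2 * (B ^ 2 / A.εa * W) := by ring
    rw [← hW, hW2] at hen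
    have : c * (min M (1 + M / A.L) ^ 2 + η ^ 2) ≤ 1 / 2 * (M ^ 2 + η ^ 2) := by gcongr
    linarith
  have hm := supNorm_update_le_mul hα hη0 (energy_spec ω t j w) hM0 hgM
    (localUpdate_apply hε ω t j w)
  have hs : √(A.L : ℝ) ≤ A.L := Real.sqrt_le_iff.2 ⟨by linarith, by nlinarith⟩
  have hm' : supNorm (localUpdate ω t j w) ≤ A.α * A.L * (M + η) := by
    calc _ ≤ A.α * (A.L * M + √A.L * η) := hm
      _ ≤ A.α * (A.L * M + A.L * η) := by gcongr
      _ = _ := by ring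
  have hαL' : A.α * A.L ≤ 1 / (16 * Lbar) := by
    rw [le_div_iff₀ (by positivity)]
    linarith
  have hM2 : M ^ 2 = B ^ 2 / A.εa * ‖γ‖ ^ 2 := by rw [hM, div_pow, mul_pow, hee]; ring
  calc supNorm (localUpdate ω t j w) ^ 2 ≤ (1 / (16 * Lbar) * (M + η)) ^ 2 := by
        refine pow_le_pow_left₀ (supNorm_nonneg _) (hm'.trans ?_) 2
        gcongr
    _ = 1 / (256 * Lbar ^ 2) * (M + η) ^ 2 := by ring
    _ ≤ 1 / (256 * Lbar ^ 2) * (2 * M ^ 2 + 2 * η ^ 2) := by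
        gcongr
        nlinarith [sq_nonneg (M - η)]
    _ ≤ 1 / (256 * Lbar ^ 2) * (4 * M ^ 2 + 16 * (B ^ 2 / A.εa * W)) := by
        refine mul_le_mul_of_nonneg_left ?_ (by positivity)
        linarith
    _ ≤ 1 / (256 * Lbar ^ 2) * (256 * (B ^ 2 / A.εa * ‖γ‖ ^ 2) + 256 * (B ^ 2 / A.εa * W)) := by
        have h3 : 0 ≤ B ^ 2 / A.εa * ‖γ‖ ^ 2 := by positivity
        have h4 : 0 ≤ B ^ 2 / A.εa * W := by positivity
        rw [hM2]
        refine mul_le_mul_of_nonneg_left ?_ (by positivity)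
        linarith
    _ = _ := by field_simp

/-- The average over the users of their noise in round `t + 1`. -/
noncomputable def roundNoise (ω : A.Batches P) (t : ℕ) : ℝ :=
  ∑ j, P.weight j * userNoise ω t j (globalModel ω t)

theorem norm_sum_weight_smul_sq_le (hK : 1 ≤ K) (hsize : ∀ j, 1 ≤ P.size j) (q : Fin K → Vec d)
    {m : Fin K → ℝ} (hq : ∀ j i, |q j i| ≤ m j) :
    ‖∑ j, P.weight j • q j‖ ^ 2 ≤ ∑ j, P.weight j * (d * m j ^ 2) := by
  have h1 : ‖∑ j, P.weight j • q j‖ ^ 2 ≤ ∑ j, P.weight j * ‖q j‖ ^ 2 :=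
    ((convexOn_univ_norm (E := Vec d)).pow (fun _ _ => norm_nonneg _) 2).map_sum_le
      (fun j _ => Problem.weight_nonneg j) (Problem.sum_weight hK hsize) fun _ _ => Set.mem_univ _
  refine h1.trans (Finset.sum_le_sum fun j _ => ?_)
  exact mul_le_mul_of_nonneg_left (norm_sq_le_card_mul (hq j)) (Problem.weight_nonneg j)

/-- The decrease of the global loss in one round. -/
theorem globalLoss_succ_le (hA : A.Admissible P) (hdiff : P.DifferentiableLoss)
    {Lbar B G : ℝ} (hLbar : 0 < Lbar) (hsm : P.Smooth Lbar) (hG : P.GradBounded G) (hG0 : 0 < G)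
    (hK : 1 ≤ K) (hd : 1 ≤ d) (hB1 : 1 ≤ B)
    (h1 : Lbar * d * B / √A.εa * (A.α * A.L) ≤ 1 / 32)
    (h2 : 4 * d * B ^ 2 * Lbar ^ 2 * (A.α ^ 2 * A.L ^ 3) / A.εa * (1 + (24 * d) ^ 2) ≤ 1 / 2)
    (hB : ∀ j, (A.batch j : ℝ) ≤ B) (ω : A.Batches P) {t : ℕ} (ht : t < A.T) :
    P.globalLoss (globalModel ω (t + 1)) ≤ P.globalLoss (globalModel ω t)
      + A.α * (-(‖gradient P.globalLoss (globalModel ω t)‖ ^ 2 / (20 * d * √A.εa))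
        + 800 * d ^ 2 * (B ^ 2 / A.εa + 1 / 2 + 2 * B ^ 2 / √A.εa)
          * ((G * √A.T + 1) * roundNoise ω t + G * A.L ^ 2 / √A.T)) := by
  have : Nonempty (Fin d) := ⟨⟨0, hd⟩⟩
  have hsize : ∀ j, 1 ≤ P.size j := fun j => (hA.one_le_batch j).trans (hA.batch_le j)
  set w := globalModel ω t with hw
  set Q : Fin K → Vec d := fun j => mixedQuant (A.bits j) (A.lam j) (localUpdate ω t j w) with hQ
  have hstep : globalModel ω (t + 1) = w + ∑ j, P.weight j • Q j := rfl
  rw [hstep]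
  refine (Problem.globalLoss_add_le hdiff hLbar.le hsm hK hsize _ _).trans ?_
  rw [add_assoc]
  refine add_le_add_right ?_ _
  have h3 := norm_sum_weight_smul_sq_le hK hsize Q
    (fun j i => abs_mixedQuant_le (hA.two_le_bits j) (hA.lam_le_one j) (localUpdate ω t j w) i)
  have h4 := mul_le_mul_of_nonneg_left h3 hLbar.le
  rw [inner_sum]
  simp only [real_inner_smul_right]
  have h5 : ∀ j ∈ Finset.univ, P.weight j * (inner ℝ (gradient P.globalLoss w) (Q j)
      + Lbar * (d * supNorm (localUpdate ω t j w) ^ 2))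
      ≤ P.weight j * (A.α * (-(‖gradient P.globalLoss w‖ ^ 2 / (20 * d * √A.εa))
        + 800 * d ^ 2 * (B ^ 2 / A.εa + 1 / 2 + 2 * B ^ 2 / √A.εa)
          * ((G * √A.T + 1) * userNoise ω t j w + G * A.L ^ 2 / √A.T))) := fun j _ =>
    mul_le_mul_of_nonneg_left (inner_mixedQuant_le hA hdiff hLbar hsm hG hG0 hK hd hB1 h1 h2 ω ht j
      (hB j) w) (Problem.weight_nonneg j)
  have h6 := Finset.sum_le_sum h5
  have h7 : ∀ p q r : ℝ, ∑ j, P.weight j * (A.α * (p + q * (r * userNoise ω t j w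
      + G * A.L ^ 2 / √A.T))) = A.α * (p + q * (r * roundNoise ω t + G * A.L ^ 2 / √A.T)) := by
    intro p q r
    have : ∀ j, P.weight j * (A.α * (p + q * (r * userNoise ω t j w + G * A.L ^ 2 / √A.T)))
        = P.weight j * (A.α * (p + q * (G * A.L ^ 2 / √A.T)))
          + A.α * q * r * (P.weight j * userNoise ω t j w) := fun j => by ring
    simp only [this]
    rw [Finset.sum_add_distrib, ← Finset.sum_mul, Problem.sum_weight hK hsize, ← Finset.mul_sum,
      roundNoise]
    ring
  rw [h7] at h6
  refine le_trans ?_ h6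
  have h8 : ∑ j, P.weight j * (inner ℝ (gradient P.globalLoss w) (Q j)
      + Lbar * (d * supNorm (localUpdate ω t j w) ^ 2))
      = ∑ j, P.weight j * inner ℝ (gradient P.globalLoss w) (Q j)
        + Lbar * ∑ j, P.weight j * (d * supNorm (localUpdate ω t j w) ^ 2) := by
    rw [Finset.mul_sum, ← Finset.sum_add_distrib]
    exact Finset.sum_congr rfl fun j _ => by ring
  rw [h8]
  exact add_le_add_right h4 _

/-- The gradient grows in one round at most by a constant factor, up to the noise. -/
theorem norm_gradient_succ_sq_le (hA : A.Admissible P) (hdiff : P.DifferentiableLoss)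
    {Lbar B : ℝ} (hLbar : 0 < Lbar) (hsm : P.Smooth Lbar)
    (hK : 1 ≤ K) (hd : 1 ≤ d) (hB1 : 1 ≤ B) (hαL : A.α * A.L * Lbar ≤ 1 / 16)
    (h2 : 4 * d * B ^ 2 * Lbar ^ 2 * (A.α ^ 2 * A.L ^ 3) / A.εa * (1 + (24 * d) ^ 2) ≤ 1 / 2)
    (hB : ∀ j, (A.batch j : ℝ) ≤ B) (ω : A.Batches P) {t : ℕ} (ht : t < A.T) :
    ‖gradient P.globalLoss (globalModel ω (t + 1))‖ ^ 2
      ≤ (2 + 2 * d * B ^ 2 / A.εa)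
        * (‖gradient P.globalLoss (globalModel ω t)‖ ^ 2 + roundNoise ω t) := by
  have : Nonempty (Fin d) := ⟨⟨0, hd⟩⟩
  have hε := hA.εa_pos
  have hsize : ∀ j, 1 ≤ P.size j := fun j => (hA.one_le_batch j).trans (hA.batch_le j)
  set w := globalModel ω t with hw
  set Q : Fin K → Vec d := fun j => mixedQuant (A.bits j) (A.lam j) (localUpdate ω t j w) with hQ
  have hstep : globalModel ω (t + 1) = w + ∑ j, P.weight j • Q j := rfl
  rw [hstep]
  set δ := ∑ j, P.weight j • Q j with hδ
  have h3 : ‖δ‖ ^ 2 ≤ _ := norm_sum_weight_smul_sq_le hK hsize Q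
    (fun j i => abs_mixedQuant_le (hA.two_le_bits j) (hA.lam_le_one j) (localUpdate ω t j w) i)
  set V := roundNoise ω t with hV
  have hV0 : 0 ≤ V := Finset.sum_nonneg fun j _ =>
    mul_nonneg (Problem.weight_nonneg j) (userNoise_nonneg ω t j _)
  set N := ‖gradient P.globalLoss w‖ ^ 2 with hN
  have hN0 : 0 ≤ N := sq_nonneg _
  have h4 : ‖δ‖ ^ 2 ≤ d * (B ^ 2 / (A.εa * Lbar ^ 2)) * (N + V) := by
    refine h3.trans ?_
    have h5 : ∀ j ∈ Finset.univ, P.weight j * (d * supNorm (localUpdate ω t j w) ^ 2)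
        ≤ P.weight j * (d * (B ^ 2 / (A.εa * Lbar ^ 2) * (N + userNoise ω t j w))) := fun j _ => by
      refine mul_le_mul_of_nonneg_left ?_ (Problem.weight_nonneg j)
      gcongr
      exact supNorm_localUpdate_sq_le hA hLbar hsm hB1 hαL h2 ω ht j (hB j) w
    refine (Finset.sum_le_sum h5).trans (le_of_eq ?_)
    have : ∀ j, P.weight j * (d * (B ^ 2 / (A.εa * Lbar ^ 2) * (N + userNoise ω t j w)))
        = P.weight j * (d * (B ^ 2 / (A.εa * Lbar ^ 2)) * N)
          + d * (B ^ 2 / (A.εa * Lbar ^ 2)) * (P.weight j * userNoise ω t j w) := fun j => by ring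
    simp only [this]
    rw [Finset.sum_add_distrib, ← Finset.sum_mul, Problem.sum_weight hK hsize, ← Finset.mul_sum,
      hV, roundNoise]
    ring
  have h5 := Problem.norm_gradient_globalLoss_sub_le hdiff hsm hK hsize (w + δ) w
  rw [add_sub_cancel_left] at h5
  have h6 : ‖gradient P.globalLoss (w + δ)‖ ≤ ‖gradient P.globalLoss w‖ + Lbar * ‖δ‖ := by
    have := norm_le_norm_add_norm_sub (gradient P.globalLoss w) (gradient P.globalLoss (w + δ))
    rw [norm_sub_rev] at this
    linarith
  calc ‖gradient P.globalLoss (w + δ)‖ ^ 2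
      ≤ (‖gradient P.globalLoss w‖ + Lbar * ‖δ‖) ^ 2 := pow_le_pow_left₀ (norm_nonneg _) h6 2
    _ ≤ 2 * N + 2 * (Lbar ^ 2 * ‖δ‖ ^ 2) := by
        rw [hN]
        nlinarith [sq_nonneg (‖gradient P.globalLoss w‖ - Lbar * ‖δ‖)]
    _ ≤ 2 * N + 2 * (Lbar ^ 2 * (d * (B ^ 2 / (A.εa * Lbar ^ 2)) * (N + V))) := by gcongr
    _ = 2 * N + 2 * d * B ^ 2 / A.εa * (N + V) := by field_simp
    _ ≤ _ := by linarith

end Params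

/-! ### Expectations over the mini-batches -/

/-- Resampling one coordinate preserves the uniform distribution on the product: exchanging that
coordinate with the fresh value is an involution on pairs. This replaces conditioning on all other
mini-batches. -/
theorem expect_update {ι : Type*} [Fintype ι] [DecidableEq ι] {β : ι → Type*}
    [∀ i, Fintype (β i)] (i : ι) [Nonempty (β i)] (f : (∀ i, β i) → ℝ) :
    𝔼 ω, f ω = 𝔼 ω, 𝔼 s : β i, f (Function.update ω i s) := by
  have hinv : Function.Involutive
      fun p : (∀ i, β i) × β i => (Function.update p.1 i p.2, p.1 i) := by
    rintro ⟨ω, s⟩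
    simp
  have h1 : ∑ p : (∀ i, β i) × β i, f (Function.update p.1 i p.2)
      = ∑ p : (∀ i, β i) × β i, f p.1 :=
    Fintype.sum_equiv hinv.toPerm _ _ fun _ => rfl
  rw [Fintype.sum_prod_type, Fintype.sum_prod_type] at h1
  simp only [Finset.sum_const, Finset.card_univ, nsmul_eq_mul] at h1
  rw [← Finset.mul_sum] at h1
  have hc : (Fintype.card (β i) : ℝ) ≠ 0 := by exact_mod_cast Fintype.card_ne_zero
  simp only [Fintype.expect_eq_sum_div_card]
  rw [← Finset.sum_div, h1]
  field_simp

/-- Double counting of pairs (element, subset); transpositions show that every element lies in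
equally many subsets. -/
theorem card_mul_card_filter_mem (n k : ℕ) (m : Fin n) :
    n * (Finset.univ.filter fun s : {S : Finset (Fin n) // S.card = k} => m ∈ s.1).card
      = k * Fintype.card {S : Finset (Fin n) // S.card = k} := by
  have hconst : ∀ m', (Finset.univ.filter
        fun s : {S : Finset (Fin n) // S.card = k} => m' ∈ s.1).card
      = (Finset.univ.filter fun s : {S : Finset (Fin n) // S.card = k} => m ∈ s.1).card := by
    intro m'
    refine Finset.card_equiv ((Equiv.finsetCongr (Equiv.swap m' m)).subtypeEquiv
      fun S => by simp) fun s => ?_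
    simp [Finset.mem_map_equiv]
  have h1 : ∑ m', (Finset.univ.filter
        fun s : {S : Finset (Fin n) // S.card = k} => m' ∈ s.1).card
      = ∑ s : {S : Finset (Fin n) // S.card = k}, s.1.card := by
    simp only [Finset.card_filter]
    rw [Finset.sum_comm]
    refine Finset.sum_congr rfl fun s _ => ?_
    simp
  simp only [hconst, fun s : {S : Finset (Fin n) // S.card = k} => s.2, Finset.sum_const,
    Finset.card_univ, Fintype.card_fin, smul_eq_mul] at h1
  rw [h1, mul_comm]

theorem expect_sum_subset {n k : ℕ} (hkn : k ≤ n) (hn : 1 ≤ n) (b : Fin n → ℝ) :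
    𝔼 s : {S : Finset (Fin n) // S.card = k}, ∑ m ∈ s.1, b m = k * ((∑ m, b m) / n) := by
  obtain ⟨S, -, hS⟩ := Finset.exists_subset_card_eq (s := (Finset.univ : Finset (Fin n))) (n := k)
    (by simpa using hkn)
  have : Nonempty {S : Finset (Fin n) // S.card = k} := ⟨⟨S, hS⟩⟩
  have hn0 : (n : ℝ) ≠ 0 := by exact_mod_cast (by omega : n ≠ 0)
  have hc : (Fintype.card {S : Finset (Fin n) // S.card = k} : ℝ) ≠ 0 := by
    exact_mod_cast Fintype.card_ne_zero
  have h1 : ∑ s : {S : Finset (Fin n) // S.card = k}, ∑ m ∈ s.1, b m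
      = ∑ m, (Finset.univ.filter
          fun s : {S : Finset (Fin n) // S.card = k} => m ∈ s.1).card * b m := by
    have h2 : ∀ s : {S : Finset (Fin n) // S.card = k}, ∑ m ∈ s.1, b m
        = ∑ m, if m ∈ s.1 then b m else 0 := fun s => by simp
    simp only [h2]
    rw [Finset.sum_comm]
    refine Finset.sum_congr rfl fun m _ => ?_
    rw [← Finset.sum_filter, Finset.sum_const, nsmul_eq_mul]
  have h3 : ∀ m, ((Finset.univ.filter
      fun s : {S : Finset (Fin n) // S.card = k} => m ∈ s.1).card : ℝ)
      = k * Fintype.card {S : Finset (Fin n) // S.card = k} / n := fun m => by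
    rw [eq_div_iff hn0, mul_comm]
    exact_mod_cast card_mul_card_filter_mem n k m
  simp only [h3] at h1
  rw [Fintype.expect_eq_sum_div_card, h1, ← Finset.mul_sum]
  field_simp

/-- Cauchy–Schwarz inside the batch gives `k ^ 2`, which is enough because batch sizes are bounded;
no cancellation between samples is used. -/
theorem expect_norm_sum_subset_sq_le {d n k : ℕ} (hkn : k ≤ n) (hn : 1 ≤ n) (a : Fin n → Vec d) :
    𝔼 s : {S : Finset (Fin n) // S.card = k}, ‖∑ m ∈ s.1, a m‖ ^ 2
      ≤ k ^ 2 * ((∑ m, ‖a m‖ ^ 2) / n) := by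
  have h1 : ∀ s ∈ (Finset.univ : Finset {S : Finset (Fin n) // S.card = k}),
      ‖∑ m ∈ s.1, a m‖ ^ 2 ≤ k * ∑ m ∈ s.1, ‖a m‖ ^ 2 := by
    intro s _
    refine (pow_le_pow_left₀ (norm_nonneg _) (norm_sum_le _ _) 2).trans ?_
    have := sq_sum_le_card_mul_sum_sq (s := s.1) (f := fun m => ‖a m‖)
    rwa [s.2] at this
  refine (Finset.expect_le_expect h1).trans (le_of_eq ?_)
  rw [← Finset.mul_expect, expect_sum_subset hkn hn]
  ring

namespace Params

variable {d K : ℕ} {X : Type u} {Y : Type v} {A : Params d K} {P : Problem d K X Y}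

/-! ### Dependence of the iterates on the mini-batches, and expected noise -/

theorem miniBatch_congr {ω ω' : A.Batches P} {t : ℕ} {j : Fin K} {h : ℕ}
    (hω : ∀ (ht : t < A.T) (hh : h < A.L), ω (⟨t, ht⟩, j, ⟨h, hh⟩) = ω' (⟨t, ht⟩, j, ⟨h, hh⟩)) :
    miniBatch ω t j h = miniBatch ω' t j h := by
  unfold miniBatch
  split_ifs with H
  · rw [hω H.1 H.2]
  · rfl

theorem localState_congr {ω ω' : A.Batches P} {t : ℕ} {j : Fin K} {h : ℕ}
    (hω : ∀ k < h, miniBatch ω t j k = miniBatch ω' t j k) (w : Vec d) :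
    localState ω t j w h = localState ω' t j w h := by
  induction h with
  | zero => rfl
  | succ h ih =>
    simp only [localState, ih fun k hk => hω k (by omega), stochGrad, hω h (by omega)]

theorem globalModel_congr {ω ω' : A.Batches P} {t : ℕ}
    (hω : ∀ s < t, ∀ j h, miniBatch ω s j h = miniBatch ω' s j h) :
    globalModel ω t = globalModel ω' t := by
  induction t with
  | zero => rfl
  | succ t ih =>
    have h1 := ih fun s hs => hω s (by omega)
    simp only [globalModel, h1, localUpdate]
    congr 1
    refine Finset.sum_congr rfl fun j _ => ?_
    rw [localState_congr fun k _ => hω t (by omega) j k]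

theorem miniBatch_update_of_ne {ω : A.Batches P} (i : Fin A.T × Fin K × Fin A.L)
    (s : {S : Finset (Fin (P.size i.2.1)) // S.card = A.batch i.2.1}) {t h : ℕ} {j : Fin K}
    (hne : t ≠ i.1 ∨ h ≠ i.2.2) :
    miniBatch (Function.update ω i s) t j h = miniBatch ω t j h := by
  refine miniBatch_congr fun ht hh => Function.update_of_ne ?_ _ _
  rintro rfl
  simp at hne

theorem nonempty_batch (hA : A.Admissible P) (j : Fin K) :
    Nonempty {S : Finset (Fin (P.size j)) // S.card = A.batch j} := by
  obtain ⟨S, -, hS⟩ := Finset.exists_subset_card_eq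
    (s := (Finset.univ : Finset (Fin (P.size j)))) (n := A.batch j)
    (by simpa using hA.batch_le j)
  exact ⟨⟨S, hS⟩⟩

theorem nonempty_batches (hA : A.Admissible P) : Nonempty (A.Batches P) :=
  ⟨fun i => (nonempty_batch hA i.2.1).some⟩

/-- The models `w` and `z` depend only on earlier batches, so they stay fixed when the current batch
is resampled. The inner average then involves a uniform subset at a fixed point, where the local
variance bound applies. -/
theorem expect_samplingError_sq_le (hA : A.Admissible P) {σl : ℝ} (hl : P.LocalVarBounded σl)
    {t h : ℕ} (ht : t < A.T) (hh : h < A.L) (j : Fin K) :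
    𝔼 ω : A.Batches P, ‖samplingError ω t j (globalModel ω t) h‖ ^ 2
      ≤ (A.batch j : ℝ) ^ 2 * σl ^ 2 := by
  have := nonempty_batches hA
  have := nonempty_batch hA j
  set i : Fin A.T × Fin K × Fin A.L := (⟨t, ht⟩, j, ⟨h, hh⟩) with hi
  have hne : Nonempty {S : Finset (Fin (P.size i.2.1)) // S.card = A.batch i.2.1} := this
  rw [expect_update i]
  refine Finset.expect_le Finset.univ_nonempty fun ω _ => ?_
  set w := globalModel ω t with hw
  set z := localModel ω t j w h with hz
  have h1 : ∀ s : {S : Finset (Fin (P.size j)) // S.card = A.batch j},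
      samplingError (Function.update ω i s) t j (globalModel (Function.update ω i s) t) h
        = ∑ n ∈ s.1, (P.sampleGrad j n z - gradient (P.localLoss j) z) := by
    intro s
    have h2 : globalModel (Function.update ω i s) t = w :=
      globalModel_congr fun t' ht' j' h' => miniBatch_update_of_ne i s (Or.inl ht'.ne)
    have h3 : localModel (Function.update ω i s) t j w h = z := by
      rw [hz, localModel, localModel,
        localState_congr fun k hk => miniBatch_update_of_ne i s (Or.inr hk.ne)]
    have h4 : miniBatch (Function.update ω i s) t j h = s.1 := by
      rw [miniBatch, dif_pos ⟨ht, hh⟩]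
      exact congrArg Subtype.val (Function.update_self i s ω)
    rw [h2, samplingError, h3, h4]
  have h5 := expect_norm_sum_subset_sq_le (hA.batch_le j)
    ((hA.one_le_batch j).trans (hA.batch_le j))
    fun n => P.sampleGrad j n z - gradient (P.localLoss j) z
  have h6 := mul_le_mul_of_nonneg_left (hl j z) (sq_nonneg (A.batch j : ℝ))
  refine le_trans (le_of_eq ?_) (h5.trans h6)
  refine Finset.expect_congr rfl fun s _ => ?_
  rw [h1]

theorem expect_roundNoise_le (hA : A.Admissible P) {σl σg B : ℝ} (hl : P.LocalVarBounded σl)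
    (hg : P.GlobalVarBounded σg) (hK : 1 ≤ K) (hB1 : 1 ≤ B) (hB : ∀ j, (A.batch j : ℝ) ≤ B)
    {t : ℕ} (ht : t < A.T) :
    𝔼 ω : A.Batches P, roundNoise ω t ≤ B ^ 2 * (A.L * A.sigmaBarSq σl σg) := by
  have := nonempty_batches hA
  have hsize : ∀ j, 1 ≤ P.size j := fun j => (hA.one_le_batch j).trans (hA.batch_le j)
  have hL' : (1 : ℝ) ≤ A.L := by exact_mod_cast hA.one_le_L
  have h1 : ∀ ω : A.Batches P, roundNoise ω t
      = ∑ j, P.weight j * ∑ h ∈ Finset.range A.L, ‖samplingError ω t j (globalModel ω t) h‖ ^ 2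
        + A.L * ∑ j, P.weight j * ‖gradient (P.localLoss j) (globalModel ω t)
          - gradient P.globalLoss (globalModel ω t)‖ ^ 2 := by
    intro ω
    rw [roundNoise, Finset.mul_sum, ← Finset.sum_add_distrib]
    refine Finset.sum_congr rfl fun j _ => ?_
    rw [userNoise]
    ring
  simp only [h1]
  rw [Finset.expect_add_distrib, Finset.expect_sum_comm]
  have h2 : ∑ j, 𝔼 ω : A.Batches P, P.weight j * ∑ h ∈ Finset.range A.L,
      ‖samplingError ω t j (globalModel ω t) h‖ ^ 2 ≤ ∑ j, P.weight j * (A.L * (B ^ 2 * σl ^ 2)) := by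
    refine Finset.sum_le_sum fun j _ => ?_
    rw [← Finset.mul_expect, Finset.expect_sum_comm]
    refine mul_le_mul_of_nonneg_left ?_ (Problem.weight_nonneg j)
    have h3 : ∀ h ∈ Finset.range A.L,
        𝔼 ω : A.Batches P, ‖samplingError ω t j (globalModel ω t) h‖ ^ 2 ≤ B ^ 2 * σl ^ 2 := by
      intro h hh
      refine (expect_samplingError_sq_le hA hl ht (Finset.mem_range.1 hh) j).trans ?_
      gcongr
      exact hB j
    refine (Finset.sum_le_sum h3).trans (le_of_eq ?_)
    simp
  have h4 : 𝔼 ω : A.Batches P, A.L * ∑ j, P.weight j * ‖gradient (P.localLoss j) (globalModel ω t)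
      - gradient P.globalLoss (globalModel ω t)‖ ^ 2 ≤ A.L * σg ^ 2 := by
    refine Finset.expect_le Finset.univ_nonempty fun ω _ => ?_
    gcongr
    exact hg _
  rw [← Finset.sum_mul, Problem.sum_weight hK hsize, one_mul] at h2
  have h5 : (A.L : ℝ) * σg ^ 2 ≤ B ^ 2 * (A.L * (6 * A.L * σg ^ 2)) := by
    have h6 : (1 : ℝ) ≤ B ^ 2 * (6 * A.L) := by nlinarith
    calc (A.L : ℝ) * σg ^ 2 = 1 * (A.L * σg ^ 2) := by ring
      _ ≤ B ^ 2 * (6 * A.L) * (A.L * σg ^ 2) := by gcongr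
      _ = _ := by ring
  rw [sigmaBarSq]
  linarith

/-! ### Summation over the rounds -/

theorem expGradSq_le (hA : A.Admissible P) (hdiff : P.DifferentiableLoss) {G : ℝ}
    (hG : P.GradBounded G) (hK : 1 ≤ K) (t : ℕ) : expGradSq A P t ≤ d * G ^ 2 := by
  have := nonempty_batches hA
  have hsize : ∀ j, 1 ≤ P.size j := fun j => (hA.one_le_batch j).trans (hA.batch_le j)
  exact Finset.expect_le Finset.univ_nonempty fun ω _ =>
    norm_sq_le_card_mul (Problem.abs_gradient_globalLoss_le hdiff hG hK hsize _)

theorem inf_expGradSq_le_average (hT : 1 ≤ A.T) :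
    A.T * (Finset.Icc 1 A.T).inf' (Finset.nonempty_Icc.mpr hT) (fun t => expGradSq A P t)
      ≤ ∑ t ∈ Finset.range A.T, expGradSq A P (t + 1) := by
  have : ∀ t ∈ Finset.range A.T,
      (Finset.Icc 1 A.T).inf' (Finset.nonempty_Icc.mpr hT) (fun t => expGradSq A P t)
        ≤ expGradSq A P (t + 1) := fun t ht =>
    Finset.inf'_le _ (Finset.mem_Icc.2 ⟨by omega, Finset.mem_range.1 ht⟩)
  refine le_trans (le_of_eq ?_) (Finset.sum_le_sum this)
  simp

/-- The bound on the average squared gradient norm for small step sizes. -/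
theorem sum_expGradSq_succ_le (hA : A.Admissible P) (hdiff : P.DifferentiableLoss)
    {Lbar B G σl σg : ℝ} (hLbar : 0 < Lbar) (hsm : P.Smooth Lbar) (hG : P.GradBounded G)
    (hG0 : 0 < G) (hl : P.LocalVarBounded σl) (hg : P.GlobalVarBounded σg)
    (hK : 1 ≤ K) (hd : 1 ≤ d) (hB1 : 1 ≤ B) (hαL : A.α * A.L * Lbar ≤ 1 / 16)
    (h1 : Lbar * d * B / √A.εa * (A.α * A.L) ≤ 1 / 32)
    (h2 : 4 * d * B ^ 2 * Lbar ^ 2 * (A.α ^ 2 * A.L ^ 3) / A.εa * (1 + (24 * d) ^ 2) ≤ 1 / 2)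
    (hB : ∀ j, (A.batch j : ℝ) ≤ B) {wstar : Vec d}
    (hmin : ∀ w, P.globalLoss wstar ≤ P.globalLoss w) :
    ∑ t ∈ Finset.range A.T, expGradSq A P (t + 1)
      ≤ (2 + 2 * d * B ^ 2 / A.εa) * (20 * d * √A.εa
        * ((P.globalLoss A.init - P.globalLoss wstar) / A.α
          + A.T * (800 * d ^ 2 * (B ^ 2 / A.εa + 1 / 2 + 2 * B ^ 2 / √A.εa)
            * ((G * √A.T + 1) * (B ^ 2 * (A.L * A.sigmaBarSq σl σg)) + G * A.L ^ 2 / √A.T)))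
        + A.T * (B ^ 2 * (A.L * A.sigmaBarSq σl σg))) := by
  have := nonempty_batches hA
  have hε := hA.εa_pos
  have hα := hA.α_pos
  have hd' : (1 : ℝ) ≤ d := by exact_mod_cast hd
  have he0 : 0 < √A.εa := Real.sqrt_pos.2 hε
  set S := B ^ 2 * (A.L * A.sigmaBarSq σl σg) with hS
  set C₁ := 800 * d ^ 2 * (B ^ 2 / A.εa + 1 / 2 + 2 * B ^ 2 / √A.εa) with hC₁
  have hC₁0 : 0 ≤ C₁ := by positivity
  set C₃ := 2 + 2 * d * B ^ 2 / A.εa with hC₃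
  have hC₃0 : 0 ≤ C₃ := by positivity
  set κ := 20 * d * √A.εa with hκ
  have hκ0 : 0 < κ := by positivity
  set R := G * A.L ^ 2 / √A.T with hR
  set f : ℕ → ℝ := fun t => 𝔼 ω : A.Batches P, P.globalLoss (globalModel ω t) with hf
  have hV : ∀ t < A.T, 𝔼 ω : A.Batches P, roundNoise ω t ≤ S := fun t ht =>
    expect_roundNoise_le hA hl hg hK hB1 hB ht
  have hdesc : ∀ t < A.T, f (t + 1)
      ≤ f t + A.α * (-(expGradSq A P t / κ) + C₁ * ((G * √A.T + 1) * S + R)) := by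
    intro t ht
    have h3 := Finset.expect_le_expect (s := (Finset.univ : Finset (A.Batches P))) fun ω _ =>
      globalLoss_succ_le hA hdiff hLbar hsm hG hG0 hK hd hB1 h1 h2 hB ω ht
    rw [Finset.expect_add_distrib, ← Finset.mul_expect, Finset.expect_add_distrib,
      Finset.expect_neg_distrib, ← Finset.expect_div, ← Finset.mul_expect,
      Finset.expect_add_distrib, ← Finset.mul_expect, Finset.expect_const Finset.univ_nonempty]
      at h3
    refine h3.trans ?_
    have h4 := hV t ht
    have h5 : 0 ≤ G * √A.T + 1 := by positivity
    simp only [hf, expGradSq]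
    gcongr
  -- Telescoping controls the gradients at `w_0, ..., w_{T-1}`, whereas the minimum runs over `w_1,
  -- ..., w_T`; this shifts the index at the cost of the factor `C₃`.
  have hgrow : ∀ t < A.T, expGradSq A P (t + 1) ≤ C₃ * (expGradSq A P t + S) := by
    intro t ht
    have h3 := Finset.expect_le_expect (s := (Finset.univ : Finset (A.Batches P))) fun ω _ =>
      norm_gradient_succ_sq_le hA hdiff hLbar hsm hK hd hB1 hαL h2 hB ω ht
    rw [← Finset.mul_expect, Finset.expect_add_distrib] at h3
    refine h3.trans ?_
    have h4 := hV t ht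
    simp only [expGradSq]
    gcongr
  set U := C₁ * ((G * √A.T + 1) * S + R) with hU
  have htel : ∀ n ≤ A.T, A.α * ∑ t ∈ Finset.range n, expGradSq A P t / κ
      ≤ f 0 - f n + n * (A.α * U) := by
    intro n
    induction n with
    | zero => simp
    | succ n ih =>
      intro hn
      have h3 := ih (by omega)
      have h4 := hdesc n (by omega)
      rw [Finset.sum_range_succ]
      push_cast
      linarith
  have h3 := htel A.T le_rfl
  have h4 : f 0 = P.globalLoss A.init :=
    Finset.expect_const (s := (Finset.univ : Finset (A.Batches P))) Finset.univ_nonempty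
      (P.globalLoss A.init)
  have h5 : P.globalLoss wstar ≤ f A.T :=
    Finset.le_expect Finset.univ_nonempty fun ω _ => hmin _
  rw [h4, ← Finset.sum_div] at h3
  have h6 : ∑ t ∈ Finset.range A.T, expGradSq A P t
      ≤ κ * ((P.globalLoss A.init - P.globalLoss wstar) / A.α + A.T * U) := by
    set Sg := ∑ t ∈ Finset.range A.T, expGradSq A P t
    have h7 : A.α * (Sg / κ) ≤ P.globalLoss A.init - P.globalLoss wstar + A.T * (A.α * U) := by
      linarith
    have h8 : κ / A.α * (A.α * (Sg / κ)) = Sg := by field_simp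
    rw [← h8]
    refine (mul_le_mul_of_nonneg_left h7 (by positivity)).trans (le_of_eq ?_)
    field_simp
  have h7 : ∑ t ∈ Finset.range A.T, expGradSq A P (t + 1)
      ≤ ∑ t ∈ Finset.range A.T, C₃ * (expGradSq A P t + S) :=
    Finset.sum_le_sum fun t ht => hgrow t (Finset.mem_range.1 ht)
  rw [← Finset.mul_sum, Finset.sum_add_distrib, Finset.sum_const, Finset.card_range,
    nsmul_eq_mul] at h7
  refine h7.trans ?_
  gcongr

/-! ### Step size conditions and comparison with `Phi` -/

theorem sigmaBarSq_nonneg (A : Params d K) (σl σg : ℝ) : 0 ≤ A.sigmaBarSq σl σg := by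
  unfold sigmaBarSq; positivity

/-- The terms of `Φ` that the bounds use. -/
theorem le_Phi (A : Params d K) (σl σg Δf : ℝ) :
    2 * A.L * A.T * A.sigmaBarSq σl σg + 4 * (A.L : ℝ) ^ 2 + A.α⁻¹ * Δf ≤ A.Phi σl σg Δf := by
  have h := sigmaBarSq_nonneg A σl σg
  have : 0 ≤ K * A.cMax ^ 2 * (2 * A.L + A.T * A.sigmaBarSq σl σg) := by positivity
  unfold Phi
  linarith

theorem stepSize_mul_le {Lbar G : ℝ} (hLbar : 0 < Lbar) (hL : 1 ≤ A.L)
    (hS : A.StepSizeOK Lbar G) : A.α * A.L * Lbar ≤ 1 / 16 := by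
  have hL' : (1 : ℝ) ≤ A.L := by exact_mod_cast hL
  have h := hS.basic.trans (min_le_left _ _)
  rw [← one_div, le_div_iff₀ (by positivity)] at h
  linarith

/-- The cube of the condition with `T ^ (-1/6)`; the constants `16` and `120` are given away. -/
theorem stepSize_cube_mul_le {Lbar G : ℝ} (hLbar : 0 < Lbar) (hG : 0 < G) (hα : 0 < A.α)
    (hL : 1 ≤ A.L) (hT : 1 ≤ A.T) (hS : A.StepSizeOK Lbar G) :
    Lbar ^ 2 * G * (A.α * A.L) ^ 3 * √A.T ≤ 1 := by
  have hL' : (1 : ℝ) ≤ A.L := by exact_mod_cast hL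
  have hT' : (1 : ℝ) ≤ A.T := by exact_mod_cast hT
  have h := hS.condI.trans (mul_le_mul_of_nonneg_left (min_le_right _ _) (by positivity))
  set p := (A.T : ℝ) ^ (1 / 6 : ℝ) with hp
  have hp0 : 0 < p := Real.rpow_pos_of_pos (by linarith) _
  set q := (1 / (120 * Lbar ^ 2 * G)) ^ (1 / 3 : ℝ) with hq
  have hp3 : p ^ 3 = √A.T := by
    rw [hp, ← Real.rpow_natCast, ← Real.rpow_mul (by linarith), Real.sqrt_eq_rpow]
    norm_num
  have hq3 : q ^ 3 = 1 / (120 * Lbar ^ 2 * G) := by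
    rw [hq, ← Real.rpow_natCast, ← Real.rpow_mul (by positivity)]
    norm_num
  have h3 : 16 * (A.α * A.L) * p ≤ q := by
    have h4 : 1 / (16 * A.L : ℝ) * (1 / p * q) = q / (16 * A.L * p) := by field_simp
    rw [h4, le_div_iff₀ (by positivity)] at h
    linarith
  have h4 := pow_le_pow_left₀ (by positivity) h3 3
  rw [mul_pow, mul_pow, hp3, hq3, le_div_iff₀ (by positivity)] at h4
  have h5 : 0 ≤ Lbar ^ 2 * G * (A.α * A.L) ^ 3 * √A.T := by positivity
  linarith

theorem div_sqrt_le_rate {G : ℝ} (hα : 0 < A.α) (hL : 1 ≤ A.L) (hT : 1 ≤ A.T) :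
    G / √A.T ≤ (1 + A.α * A.L * G * √A.T) / (A.α * A.L * A.T) := by
  have hL' : (0 : ℝ) < A.L := by exact_mod_cast hL
  have hT' : (0 : ℝ) < A.T := by exact_mod_cast hT
  have hsT : 0 < √(A.T : ℝ) := Real.sqrt_pos.2 hT'
  have h : (1 + A.α * A.L * G * √A.T) * √A.T = √A.T + A.α * A.L * G * (√A.T * √A.T) := by ring
  rw [div_le_div_iff₀ hsT (by positivity), h, Real.mul_self_sqrt hT'.le]
  linarith

/-- If the step size is not small, then the right-hand side of the bound dominates `G ^ 2`. -/
theorem sq_le_of_large_step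
    {Lbar G σl σg Δf : ℝ} (hLbar : 0 < Lbar) (hG : 0 < G) (hα : 0 < A.α)
    (hL : 1 ≤ A.L) (hT : 1 ≤ A.T) (hΔ : 0 ≤ Δf) (hS : A.StepSizeOK Lbar G) :
    Lbar ^ 2 * G ^ 2 * (A.α ^ 3 * A.L ^ 5)
      ≤ (1 + A.α * A.L * G * √A.T) / (A.α * A.L * A.T) * A.Phi σl σg Δf := by
  have hL' : (1 : ℝ) ≤ A.L := by exact_mod_cast hL
  have hT' : (1 : ℝ) ≤ A.T := by exact_mod_cast hT
  have hsT : 0 < √(A.T : ℝ) := Real.sqrt_pos.2 (by linarith)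
  have hsT2 : √(A.T : ℝ) * √A.T = A.T := Real.mul_self_sqrt (by linarith)
  have h1 : (A.L : ℝ) ^ 2 ≤ A.Phi σl σg Δf := by
    refine le_trans ?_ (le_Phi A σl σg Δf)
    have := sigmaBarSq_nonneg A σl σg
    have h2 : 0 ≤ 2 * A.L * A.T * A.sigmaBarSq σl σg := by positivity
    have h3 : 0 ≤ A.α⁻¹ * Δf := by positivity
    nlinarith
  have h2 : G / √A.T ≤ (1 + A.α * A.L * G * √A.T) / (A.α * A.L * A.T) :=
    div_sqrt_le_rate hα hL hT
  have h3 := stepSize_cube_mul_le hLbar hG hα hL hT hS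
  have h4 : Lbar ^ 2 * G * (A.α * A.L) ^ 3 ≤ 1 / √A.T := by rwa [le_div_iff₀ hsT]
  calc Lbar ^ 2 * G ^ 2 * (A.α ^ 3 * A.L ^ 5)
      = Lbar ^ 2 * G * (A.α * A.L) ^ 3 * G * A.L ^ 2 := by ring
    _ ≤ 1 / √A.T * G * A.L ^ 2 := by gcongr
    _ = G / √A.T * A.L ^ 2 := by ring
    _ ≤ _ := by gcongr

/-- The error terms of the small step size bound are dominated by the right-hand side. -/
theorem error_terms_le
    {Lbar G σl σg Δf : ℝ} (hLbar : 0 < Lbar) (hG : 0 < G) (hα : 0 < A.α)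
    (hL : 1 ≤ A.L) (hT : 1 ≤ A.T) (hΔ : 0 ≤ Δf) (hαL : A.α * A.L * Lbar ≤ 1 / 16) :
    Δf / A.α / A.T ≤ 1 / Lbar
        * ((1 + A.α * A.L * G * √A.T) / (A.α * A.L * A.T) * A.Phi σl σg Δf) ∧
      A.L * A.sigmaBarSq σl σg ≤ 1 / Lbar
        * ((1 + A.α * A.L * G * √A.T) / (A.α * A.L * A.T) * A.Phi σl σg Δf) ∧
      G * √A.T * (A.L * A.sigmaBarSq σl σg) + G * A.L ^ 2 / √A.T
        ≤ (1 + A.α * A.L * G * √A.T) / (A.α * A.L * A.T) * A.Phi σl σg Δf := by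
  have hL' : (1 : ℝ) ≤ A.L := by exact_mod_cast hL
  have hT' : (1 : ℝ) ≤ A.T := by exact_mod_cast hT
  have hsT : 0 < √(A.T : ℝ) := Real.sqrt_pos.2 (by linarith)
  have hsT2 : √(A.T : ℝ) * √A.T = A.T := Real.mul_self_sqrt (by linarith)
  have hσ := sigmaBarSq_nonneg A σl σg
  set s := A.sigmaBarSq σl σg
  have hΦ := le_Phi A σl σg Δf
  set Φ := A.Phi σl σg Δf
  have ha : 0 ≤ 2 * A.L * A.T * s := by positivity
  have hb : 0 ≤ A.α⁻¹ * Δf := by positivity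
  have hc : (0 : ℝ) ≤ (A.L : ℝ) ^ 2 := by positivity
  have hΦ0 : 0 ≤ Φ := by linarith
  have hΦ1 : Δf / A.α ≤ Φ := by rw [div_eq_inv_mul]; linarith
  have hΦ2 : A.L * s * A.T ≤ Φ := by linarith
  have hΦ3 : A.L * s * A.T + A.L ^ 2 ≤ Φ := by linarith
  set c := (1 + A.α * A.L * G * √A.T) / (A.α * A.L * A.T) with hcdef
  -- Only the summand 1 of the numerator is kept, together with `α L Lbar ≤ 1`.
  have hc1 : 1 / A.T ≤ 1 / Lbar * c := by
    rw [hcdef, div_mul_div_comm, div_le_div_iff₀ (by positivity) (by positivity)]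
    have h1 : 0 ≤ A.α * A.L * G * √A.T := by positivity
    have h2 : A.α * A.L * Lbar * A.T ≤ 1 * A.T := by gcongr; linarith
    have h3 : 0 ≤ A.α * A.L * G * √A.T * A.T := by positivity
    linarith
  have hc2 : G / √A.T ≤ c := div_sqrt_le_rate hα hL hT
  refine ⟨?_, ?_, ?_⟩
  · calc Δf / A.α / A.T = 1 / A.T * (Δf / A.α) := by ring
      _ ≤ 1 / Lbar * c * Φ := by gcongr
      _ = _ := by ring
  · calc A.L * s = 1 / A.T * (A.L * s * A.T) := by field_simp
      _ ≤ 1 / Lbar * c * Φ := by gcongr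
      _ = _ := by ring
  · calc G * √A.T * (A.L * s) + G * A.L ^ 2 / √A.T
        = G / √A.T * (A.L * s * (√A.T * √A.T) + A.L ^ 2) := by field_simp
      _ = G / √A.T * (A.L * s * A.T + A.L ^ 2) := by rw [hsT2]
      _ ≤ c * Φ := by gcongr

theorem error_arith {C₁ C₃ κ B q p S R Δ Ψ : ℝ} (hC₁ : 0 ≤ C₁) (hC₃ : 0 ≤ C₃) (hκ : 0 ≤ κ)
    (hB : 1 ≤ B) (hR : 0 ≤ R) (h1 : Δ ≤ 1 / q * Ψ) (h2 : S ≤ 1 / q * Ψ)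
    (h3 : p * S + R ≤ Ψ) :
    C₃ * (κ * (Δ + C₁ * ((p + 1) * (B ^ 2 * S) + R)) + B ^ 2 * S)
      ≤ C₃ * (κ * (1 / q + C₁ * (B ^ 2 + B ^ 2 / q)) + B ^ 2 / q) * Ψ := by
  have hB2 : 1 ≤ B ^ 2 := one_le_pow₀ hB
  have h4 : (p + 1) * (B ^ 2 * S) + R ≤ (B ^ 2 + B ^ 2 / q) * Ψ := by
    calc (p + 1) * (B ^ 2 * S) + R ≤ (p + 1) * (B ^ 2 * S) + B ^ 2 * R :=
          add_le_add_right (le_mul_of_one_le_left hR hB2) _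
      _ = B ^ 2 * (p * S + R) + B ^ 2 * S := by ring
      _ ≤ B ^ 2 * Ψ + B ^ 2 * (1 / q * Ψ) := by gcongr
      _ = _ := by ring
  calc _ ≤ C₃ * (κ * (1 / q * Ψ + C₁ * ((B ^ 2 + B ^ 2 / q) * Ψ)) + B ^ 2 * (1 / q * Ψ)) := by
        gcongr
    _ = _ := by ring

/-- Each failed smallness condition bounds `α³ ℓ⁵` below: the first after cubing, the second after
cubing and a square root, as `α⁶ ℓ⁹ ≤ (α³ ℓ⁵)²`. -/
theorem min_le_of_large_step {c₁ c₂ α ℓ : ℝ} (hα : 0 ≤ α) (hℓ : 1 ≤ ℓ) (hc₁ : 0 < c₁)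
    (hc₂ : 0 < c₂) (h : ¬(c₁ * (α * ℓ) ≤ 1 / 32 ∧ c₂ * (α ^ 2 * ℓ ^ 3) ≤ 1 / 2)) :
    min ((1 / (32 * c₁)) ^ 3) √((1 / (2 * c₂)) ^ 3) ≤ α ^ 3 * ℓ ^ 5 := by
  have hℓ0 : 0 ≤ ℓ := by linarith
  rw [not_and_or, not_le, not_le] at h
  rcases h with h | h
  · refine (min_le_left _ _).trans ?_
    have h2 : 1 / (32 * c₁) ≤ α * ℓ := by
      rw [div_le_iff₀ (by positivity)]
      linarith
    calc (1 / (32 * c₁)) ^ 3 ≤ (α * ℓ) ^ 3 := pow_le_pow_left₀ (by positivity) h2 3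
      _ = α ^ 3 * ℓ ^ 3 := by ring
      _ ≤ α ^ 3 * ℓ ^ 5 :=
        mul_le_mul_of_nonneg_left (pow_le_pow_right₀ hℓ (by norm_num)) (by positivity)
  · refine (min_le_right _ _).trans ?_
    have h2 : 1 / (2 * c₂) ≤ α ^ 2 * ℓ ^ 3 := by
      rw [div_le_iff₀ (by positivity)]
      linarith
    refine Real.sqrt_le_iff.2 ⟨by positivity, ?_⟩
    calc (1 / (2 * c₂)) ^ 3 ≤ (α ^ 2 * ℓ ^ 3) ^ 3 := pow_le_pow_left₀ (by positivity) h2 3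
      _ = α ^ 6 * ℓ ^ 9 := by ring
      _ ≤ α ^ 6 * ℓ ^ 10 :=
        mul_le_mul_of_nonneg_left (pow_le_pow_right₀ hℓ (by norm_num)) (by positivity)
      _ = (α ^ 3 * ℓ ^ 5) ^ 2 := by ring

end Params

end FedAvg

theorem proposition1 (d maxBatch : ℕ) (Lbar εa : ℝ) (hLbar : 0 < Lbar) (hεa : 0 < εa) :
    ∃ C : ℝ, 0 < C ∧
      ∀ (K : ℕ) (X : Type u) (Y : Type v) (P : FedAvg.Problem d K X Y) (A : FedAvg.Params d K)
        (G σl σg : ℝ) (wstar : FedAvg.Vec d) (hA : A.Admissible P),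
        1 ≤ K →
        A.εa = εa →
        (∀ j, A.batch j ≤ maxBatch) →
        P.DifferentiableLoss →
        P.Smooth Lbar →
        0 < G →
        P.GradBounded G →
        P.LocalVarBounded σl →
        P.GlobalVarBounded σg →
        (∀ w, P.globalLoss wstar ≤ P.globalLoss w) →
        A.StepSizeOK Lbar G →
        (Finset.Icc 1 A.T).inf' (Finset.nonempty_Icc.mpr hA.one_le_T)
            (fun t => FedAvg.Params.expGradSq A P t)
          ≤ C * ((1 + A.α * A.L * G * √(A.T : ℝ)) / (A.α * A.L * A.T)
              * A.Phi σl σg (P.globalLoss A.init - P.globalLoss wstar)) := by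
  -- The added 1 ensures `B ≥ 1` even when `maxBatch = 0`.
  set B : ℝ := maxBatch + 1 with hB
  have hB1 : 1 ≤ B := by rw [hB]; linarith [Nat.cast_nonneg (α := ℝ) maxBatch]
  have he0 : 0 < √εa := Real.sqrt_pos.2 hεa
  set c₁ : ℝ := Lbar * d * B / √εa with hc₁
  set c₂ : ℝ := 4 * d * B ^ 2 * Lbar ^ 2 / εa * (1 + (24 * d) ^ 2) with hc₂
  set s₁ : ℝ := (1 / (32 * c₁)) ^ 3 with hs₁
  set s₂ : ℝ := √((1 / (2 * c₂)) ^ 3) with hs₂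
  set C₁ : ℝ := 800 * d ^ 2 * (B ^ 2 / εa + 1 / 2 + 2 * B ^ 2 / √εa) with hC₁
  set C₃ : ℝ := 2 + 2 * d * B ^ 2 / εa with hC₃
  set κ : ℝ := 20 * d * √εa with hκ
  set C₄ : ℝ := C₃ * (κ * (1 / Lbar + C₁ * (B ^ 2 + B ^ 2 / Lbar)) + B ^ 2 / Lbar) with hC₄
  set C₅ : ℝ := d / (Lbar ^ 2 * min s₁ s₂) with hC₅
  have hc₁0 : 0 ≤ c₁ := by positivity
  have hc₂0 : 0 ≤ c₂ := by positivity
  have hs₁0 : 0 ≤ s₁ := by positivity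
  have hs₂0 : 0 ≤ s₂ := by positivity
  have hs0 : 0 ≤ min s₁ s₂ := le_min hs₁0 hs₂0
  have hC₁0 : 0 ≤ C₁ := by positivity
  have hC₃0 : 0 ≤ C₃ := by positivity
  have hκ0 : 0 ≤ κ := by positivity
  have hC₄0 : 0 ≤ C₄ := by positivity
  have hC₅0 : 0 ≤ C₅ := by positivity
  -- `C₄` serves small steps and `C₅` large ones; the summand 1 keeps the constant positive in every
  -- case, including `d = 0`.
  refine ⟨C₄ + C₅ + 1, by positivity, ?_⟩
  clear_value B c₁ c₂ s₁ s₂ C₁ C₃ κ C₄ C₅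
  intro K X Y P A G σl σg wstar hA hK hAε hbatch hdiff hsm hG0 hG hl hg hmin hstep
  have hα := hA.α_pos
  have hL' : (1 : ℝ) ≤ A.L := by exact_mod_cast hA.one_le_L
  have hT' : (1 : ℝ) ≤ A.T := by exact_mod_cast hA.one_le_T
  have hΔ : 0 ≤ P.globalLoss A.init - P.globalLoss wstar := sub_nonneg.2 (hmin _)
  have hαL := FedAvg.Params.stepSize_mul_le hLbar hA.one_le_L hstep
  have hbatchB : ∀ j, (A.batch j : ℝ) ≤ B := fun j => by
    have : (A.batch j : ℝ) ≤ maxBatch := by exact_mod_cast hbatch j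
    linarith
  have hlarge := FedAvg.Params.sq_le_of_large_step (σl := σl) (σg := σg) hLbar hG0 hα
    hA.one_le_L hA.one_le_T hΔ hstep
  obtain ⟨he1, he2, he3⟩ := FedAvg.Params.error_terms_le (σl := σl) (σg := σg) hLbar hG0 hα
    hA.one_le_L hA.one_le_T hΔ hαL
  set Δf := P.globalLoss A.init - P.globalLoss wstar with hΔf
  set Ψ := (1 + A.α * A.L * G * √(A.T : ℝ)) / (A.α * A.L * A.T) * A.Phi σl σg Δf with hΨ
  clear_value Ψ Δf
  have hΨ0 : 0 ≤ Ψ := le_trans (by positivity) hlarge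
  have htriv : (Finset.Icc 1 A.T).inf' (Finset.nonempty_Icc.mpr hA.one_le_T)
      (fun t => FedAvg.Params.expGradSq A P t) ≤ d * G ^ 2 :=
    (Finset.inf'_le _ (Finset.mem_Icc.2 ⟨le_rfl, hA.one_le_T⟩)).trans
      (FedAvg.Params.expGradSq_le hA hdiff hG hK 1)
  -- In dimension 0 there is no largest coordinate, but the trivial bound `d * G ^ 2` vanishes.
  rcases Nat.eq_zero_or_pos d with hd | hd
  · have : (d : ℝ) * G ^ 2 = 0 := by simp [hd]
    rw [this] at htriv
    exact htriv.trans (by positivity)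
  have hd' : (0 : ℝ) < d := by exact_mod_cast hd
  by_cases hsmall : c₁ * (A.α * A.L) ≤ 1 / 32 ∧ c₂ * (A.α ^ 2 * A.L ^ 3) ≤ 1 / 2
  · have h1 := FedAvg.Params.sum_expGradSq_succ_le hA hdiff hLbar hsm hG hG0 hl hg hK hd hB1 hαL
      (by rw [hAε, ← hc₁]; exact hsmall.1)
      (by rw [hAε]; refine le_trans (le_of_eq ?_) hsmall.2; rw [hc₂]; ring) hbatchB hmin
    rw [hAε, ← hΔf, ← hC₁, ← hC₃, ← hκ] at h1
    have h2 := (FedAvg.Params.inf_expGradSq_le_average hA.one_le_T).trans h1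
    set I := (Finset.Icc 1 A.T).inf' (Finset.nonempty_Icc.mpr hA.one_le_T)
      (fun t => FedAvg.Params.expGradSq A P t)
    set S := A.L * A.sigmaBarSq σl σg with hS
    have h3 : I ≤ C₃ * (κ * (Δf / A.α / A.T
        + C₁ * ((G * √A.T + 1) * (B ^ 2 * S) + G * A.L ^ 2 / √A.T)) + B ^ 2 * S) := by
      refine le_of_mul_le_mul_left (h2.trans (le_of_eq ?_)) (by linarith : (0 : ℝ) < A.T)
      field_simp
    have h4 := FedAvg.Params.error_arith hC₁0 hC₃0 hκ0 hB1 (by positivity) he1 he2 he3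
    rw [← hC₄] at h4
    exact (h3.trans h4).trans (mul_le_mul_of_nonneg_right (by linarith) hΨ0)
  · have hc₁p : 0 < c₁ := by rw [hc₁]; positivity
    have hc₂p : 0 < c₂ := by rw [hc₂]; positivity
    have hs₁p : 0 < s₁ := by rw [hs₁]; positivity
    have hs₂p : 0 < s₂ := hs₂ ▸ Real.sqrt_pos.2 (by positivity)
    have hsp : 0 < min s₁ s₂ := lt_min hs₁p hs₂p
    have h1 : min s₁ s₂ ≤ A.α ^ 3 * A.L ^ 5 := by
      rw [hs₁, hs₂]
      exact FedAvg.Params.min_le_of_large_step hα.le hL' hc₁p hc₂p hsmall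
    refine htriv.trans ?_
    calc d * G ^ 2 = C₅ * (Lbar ^ 2 * G ^ 2 * min s₁ s₂) := by rw [hC₅]; field_simp
      _ ≤ C₅ * (Lbar ^ 2 * G ^ 2 * (A.α ^ 3 * A.L ^ 5)) := by gcongr
      _ ≤ C₅ * Ψ := by gcongr
      _ ≤ (C₄ + C₅ + 1) * Ψ := mul_le_mul_of_nonneg_right (by linarith) hΨ0
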